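/- Let $n$ be a positive integer, let $R$ and $S$ be associative unital rings, and let $C={}_SC_R$ be a semidualizing $(S,R)$-bimodule, i.e.: ${}_SC$ and $C_R$ both admit resolutions $\cdots\to F_1\to F_0\to C\to 0$ by finitely generated projective (equivalently, finitely generated free) $S$-modules, respectively right $R$-modules; the homothety maps $S\to\operatorname{Hom}_{R^{op}}(C,C)$ and $R\to\operatorname{Hom}_S(C,C)$ are bijective; and $\operatorname{Ext}^i_S(C,C)=0=\operatorname{Ext}^i_{R^{op}}(C,C)$ for all $i\ge 1$. Modules are left modules unless stated otherwise. A (left or right) module $L$ over a ring is finitely $n$-presented if there is an exact sequence $F_n\to F_{n-1}\to\cdots\to F_0\to L\to 0$ with all $F_i$ finitely generated free. A left module $X$ over a ring $A$ is $fp_n$-injective if for every injective homomorphism $K\to L$ of finitely $n$-presented left $A$-modules the map $\operatorname{Hom}_A(L,X)\to\operatorname{Hom}_A(K,X)$ is surjective; it is $fp_n$-flat if for every injective homomorphism $K\to L$ of finitely $n$-presented right $A$-modules the map $K\otimes_A X\to L\otimes_A X$ is injective. Let $Cfp_nI(R)$ be the class of $R$-modules isomorphic to $\operatorname{Hom}_S(C,X)$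 for some $fp_n$-injective $S$-module $X$, and let $Cfp_nF(S)$ be the class of $S$-modules isomorphic to $C\otimes_R Y$ for some $fp_n$-flat $R$-module $Y$. A submodule $M'$ of a left $A$-module $M$ is pure if $0\to B\otimes_A M'\to B\otimes_A M\to B\otimes_A (M/M')\to 0$ is exact for every right $A$-module $B$. Let $M'$ be a pure submodule of an $R$-module $M$ and let $N'$ be a pure submodule of an $S$-module $N$. Then: (i) $M\in Cfp_nI(R)$ if and only if $M'\in Cfp_nI(R)$ and $M/M'\in Cfp_nI(R)$; (ii) $N\in Cfp_nF(S)$ if and only if $N'\in Cfp_nF(S)$ and $N/N'\in Cfp_nF(S)$. -/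

import Mathlib

universe u

namespace CFp

open scoped TensorProduct MulOpposite

/-! Right `R`-modules are modules over `Rᵐᵒᵖ`; the right action of `r` on `a` is
`MulOpposite.op r • a`.  An `(S, R)`-bimodule is an abelian group with commuting actions of `S` and
of `Rᵐᵒᵖ`. -/

section TensorOverRing

variable (R : Type u) [Ring R]
variable (A : Type u) [AddCommGroup A] [Module Rᵐᵒᵖ A]
variable (M : Type u) [AddCommGroup M] [Module R M]

/-- The subgroup of `A ⊗[ℤ] M` generated by all `(a r) ⊗ m - a ⊗ (r m)`. -/
def balancedRel : AddSubgroup (A ⊗[ℤ] M) :=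
  AddSubgroup.closure {t | ∃ (a : A) (r : R) (m : M),
    t = (MulOpposite.op r • a) ⊗ₜ[ℤ] m - a ⊗ₜ[ℤ] (r • m)}

/-- The tensor product `A ⊗_R M` of a right and a left module over a possibly noncommutative
ring `R`, as an abelian group. -/
def Tensor : Type u := (A ⊗[ℤ] M) ⧸ balancedRel R A M

instance : AddCommGroup (Tensor R A M) :=
  inferInstanceAs (AddCommGroup ((A ⊗[ℤ] M) ⧸ balancedRel R A M))

variable {A M}

/-- The pure tensor `a ⊗ m` in `A ⊗_R M`. -/
def Tensor.tmul (a : A) (m : M) : Tensor R A M :=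
  QuotientAddGroup.mk' (balancedRel R A M) (a ⊗ₜ[ℤ] m)

variable {A' M' : Type u} [AddCommGroup A'] [Module Rᵐᵒᵖ A'] [AddCommGroup M'] [Module R M']

/-- The additive map `f ⊗ g : A ⊗_R M → A' ⊗_R M'` with `a ⊗ m ↦ f a ⊗ g m`. -/
def Tensor.map (f : A →ₗ[Rᵐᵒᵖ] A') (g : M →ₗ[R] M') : Tensor R A M →+ Tensor R A' M' :=
  QuotientAddGroup.map (balancedRel R A M) (balancedRel R A' M')
    (TensorProduct.map f.toAddMonoidHom.toIntLinearMap
      g.toAddMonoidHom.toIntLinearMap).toAddMonoidHom (by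
    rw [balancedRel, AddSubgroup.closure_le]
    rintro _ ⟨a, r, m, rfl⟩
    exact AddSubgroup.subset_closure ⟨f a, r, g m, by simp⟩)

theorem Tensor.map_tmul (f : A →ₗ[Rᵐᵒᵖ] A') (g : M →ₗ[R] M') (a : A) (m : M) :
    Tensor.map R f g (Tensor.tmul R a m) = Tensor.tmul R (f a) (g m) := rfl

end TensorOverRing

section BimoduleTensor

variable (R S : Type u) [Ring R] [Ring S]
variable (C : Type u) [AddCommGroup C] [Module S C] [Module Rᵐᵒᵖ C] [SMulCommClass S Rᵐᵒᵖ C]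
variable (Y : Type u) [AddCommGroup Y] [Module R Y]

/-- The action of `S` on `C` induces a ring homomorphism from `S` to the additive endomorphisms of
`C ⊗_R Y`, where `s` acts by `c ⊗ y ↦ (s c) ⊗ y`. -/
def Tensor.leftAction : S →+* AddMonoid.End (Tensor R C Y) where
  toFun s := Tensor.map R (Module.toModuleEnd Rᵐᵒᵖ (S := S) C s) LinearMap.id
  map_one' := by
    ext x
    obtain ⟨x, rfl⟩ := QuotientAddGroup.mk_surjective x
    induction x with
    | zero => exact map_zero _
    | tmul c y => exact congrArg (Tensor.tmul R · y) (one_smul S c)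
    | add x y hx hy => exact (map_add _ _ _).trans (congrArg₂ (· + ·) hx hy)
  map_mul' s t := by
    ext x
    obtain ⟨x, rfl⟩ := QuotientAddGroup.mk_surjective x
    induction x with
    | zero => exact (map_zero _).trans (map_zero _).symm
    | tmul c y => exact congrArg (Tensor.tmul R · y) (mul_smul s t c)
    | add x y hx hy =>
      exact (map_add _ _ _).trans ((congrArg₂ (· + ·) hx hy).trans (map_add _ _ _).symm)
  map_zero' := by
    ext x
    obtain ⟨x, rfl⟩ := QuotientAddGroup.mk_surjective x
    induction x with
    | zero => exact map_zero _
    | tmul c y =>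
      refine (congrArg (Tensor.tmul R · y) (zero_smul S c)).trans ?_
      exact congrArg (QuotientAddGroup.mk' _) (TensorProduct.zero_tmul _ _)
    | add x y hx hy =>
      exact (map_add _ _ _).trans ((congrArg₂ (· + ·) hx hy).trans (map_add _ _ _).symm)
  map_add' s t := by
    ext x
    obtain ⟨x, rfl⟩ := QuotientAddGroup.mk_surjective x
    induction x with
    | zero => exact (map_zero _).trans (map_zero (_ : AddMonoid.End (Tensor R C Y))).symm
    | tmul c y =>
      refine (congrArg (Tensor.tmul R · y) (add_smul s t c)).trans ?_
      exact congrArg (QuotientAddGroup.mk' _) (TensorProduct.add_tmul _ _ _)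
    | add x y hx hy =>
      exact (map_add _ _ _).trans ((congrArg₂ (· + ·) hx hy).trans
        (map_add (_ : AddMonoid.End (Tensor R C Y)) _ _).symm)

/-- For an `(S, R)`-bimodule `C` and an `R`-module `Y`, the tensor product `C ⊗_R Y` is an
`S`-module through `s (c ⊗ y) = (s c) ⊗ y`. -/
instance : Module S (Tensor R C Y) := Module.compHom _ (Tensor.leftAction R S C Y)

variable {R C Y} in
theorem Tensor.smul_tmul' (s : S) (c : C) (y : Y) :
    s • Tensor.tmul R c y = Tensor.tmul R (s • c) y := rfl

end BimoduleTensor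

section BimoduleHom

variable (R S : Type u) [Ring R] [Ring S]
variable (C : Type u) [AddCommGroup C] [Module S C] [Module Rᵐᵒᵖ C] [SMulCommClass S Rᵐᵒᵖ C]
variable (X : Type u) [AddCommGroup X] [Module S X]

/-- The abelian group `Hom_S(C, X)`, as a separate type to carry the `R`-module structure below. -/
def BimoduleHom (S C X : Type u) [Ring S] [AddCommGroup C] [Module S C]
    [AddCommGroup X] [Module S X] : Type u := C →ₗ[S] X

instance : AddCommGroup (BimoduleHom S C X) := inferInstanceAs (AddCommGroup (C →ₗ[S] X))

instance : FunLike (BimoduleHom S C X) C X := inferInstanceAs (FunLike (C →ₗ[S] X) C X)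

/-- For an `(S, R)`-bimodule `C`, `Hom_S(C, X)` is an `R`-module through `(r f)(c) = f (c r)`. -/
instance : Module R (BimoduleHom S C X) where
  smul r f := LinearMap.comp (show C →ₗ[S] X from f)
    ({ toFun := fun c => MulOpposite.op r • c
       map_add' := smul_add _
       map_smul' := fun s c => (smul_comm s (MulOpposite.op r) c).symm } : C →ₗ[S] C)
  one_smul f := LinearMap.ext fun c => congrArg f (one_smul Rᵐᵒᵖ c)
  mul_smul r r' f := LinearMap.ext fun c =>
    congrArg f (mul_smul (MulOpposite.op r') (MulOpposite.op r) c)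
  smul_zero _ := rfl
  smul_add _ _ _ := rfl
  add_smul r r' f := LinearMap.ext fun c =>
    (congrArg f (add_smul (MulOpposite.op r) (MulOpposite.op r') c)).trans
      (LinearMap.map_add (show C →ₗ[S] X from f) _ _)
  zero_smul f := LinearMap.ext fun c =>
    (congrArg f (zero_smul Rᵐᵒᵖ c)).trans (LinearMap.map_zero (show C →ₗ[S] X from f))

variable {R S C X} in
theorem BimoduleHom.smul_apply (r : R) (f : BimoduleHom S C X) (c : C) :
    (r • f) c = f (MulOpposite.op r • c) := rfl

end BimoduleHom

section Finiteness

variable (R : Type u) [Ring R] (M : Type u) [AddCommGroup M] [Module R M]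

/-- `M` is finitely `n`-presented: there is an exact sequence
`F_n → F_{n-1} → ⋯ → F_1 → F_0 → M → 0` with each `F_i = R ^ (k i)` finitely generated free
(the maps `d i : F_{i+1} → F_i` with `i ≥ n` are irrelevant). -/
def FinitelyNPresented (n : ℕ) : Prop :=
  ∃ (k : ℕ → ℕ) (ε : (Fin (k 0) → R) →ₗ[R] M)
    (d : ∀ i, (Fin (k (i + 1)) → R) →ₗ[R] (Fin (k i) → R)),
    Function.Surjective ε ∧ (1 ≤ n → Function.Exact (d 0) ε) ∧
      ∀ i, i + 2 ≤ n → Function.Exact (d (i + 1)) (d i)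

/-- `M` admits a degreewise finite projective resolution: there is an exact sequence
`⋯ → F_1 → F_0 → M → 0` with each `F_i = R ^ (k i)` finitely generated free (equivalently, with
finitely generated projective terms). -/
def HasDegreewiseFiniteResolution : Prop :=
  ∃ (k : ℕ → ℕ) (ε : (Fin (k 0) → R) →ₗ[R] M)
    (d : ∀ i, (Fin (k (i + 1)) → R) →ₗ[R] (Fin (k i) → R)),
    Function.Surjective ε ∧ Function.Exact (d 0) ε ∧ ∀ i, Function.Exact (d (i + 1)) (d i)

end Finiteness

/-- `M` is `fp_n`-injective: for every exact `0 → K → L` with `K`, `L` finitely `n`-presented,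
`Hom_R(L, M) → Hom_R(K, M)` is surjective. -/
def IsFpInjective (R : Type u) [Ring R] (n : ℕ) (M : Type u) [AddCommGroup M] [Module R M] : Prop :=
  ∀ (K L : Type u) [AddCommGroup K] [Module R K] [AddCommGroup L] [Module R L] (f : K →ₗ[R] L),
    FinitelyNPresented R K n → FinitelyNPresented R L n → Function.Injective f →
      Function.Surjective (fun g : L →ₗ[R] M => g.comp f)

/-- `M` is `fp_n`-flat: for every exact `0 → K → L` of finitely `n`-presented right modules,
`K ⊗_R M → L ⊗_R M` is injective. -/
def IsFpFlat (R : Type u) [Ring R] (n : ℕ) (M : Type u) [AddCommGroup M] [Module R M] : Prop :=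
  ∀ (K L : Type u) [AddCommGroup K] [Module Rᵐᵒᵖ K] [AddCommGroup L] [Module Rᵐᵒᵖ L]
    (f : K →ₗ[Rᵐᵒᵖ] L),
    FinitelyNPresented Rᵐᵒᵖ K n → FinitelyNPresented Rᵐᵒᵖ L n → Function.Injective f →
      Function.Injective (Tensor.map R f (LinearMap.id : M →ₗ[R] M))

/-- The `(S, R)`-bimodule `C` is semidualizing. -/
structure IsSemidualizing (S R : Type u) [Ring S] [Ring R] (C : Type u) [AddCommGroup C]
    [Module S C] [Module Rᵐᵒᵖ C] [SMulCommClass S Rᵐᵒᵖ C] : Prop where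
  left_resolution : HasDegreewiseFiniteResolution S C
  right_resolution : HasDegreewiseFiniteResolution Rᵐᵒᵖ C
  /-- The homothety map `S → Hom_{Rᵒᵖ}(C, C)`, `s ↦ (c ↦ s c)`, is bijective. -/
  left_homothety : Function.Bijective
    (fun s : S => (DistribSMul.toLinearMap Rᵐᵒᵖ C s : C →ₗ[Rᵐᵒᵖ] C))
  /-- The homothety map `R → Hom_S(C, C)`, `r ↦ (c ↦ c r)`, is bijective. -/
  right_homothety :
    haveI : SMulCommClass Rᵐᵒᵖ S C := SMulCommClass.symm S Rᵐᵒᵖ C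
    Function.Bijective
      (fun r : R => (DistribSMul.toLinearMap S C (MulOpposite.op r) : C →ₗ[S] C))
  left_ext : ∀ i : ℕ, 1 ≤ i →
    Subsingleton (CategoryTheory.Abelian.Ext (ModuleCat.of S C) (ModuleCat.of S C) i)
  right_ext : ∀ i : ℕ, 1 ≤ i →
    Subsingleton (CategoryTheory.Abelian.Ext (ModuleCat.of Rᵐᵒᵖ C) (ModuleCat.of Rᵐᵒᵖ C) i)

section Classes

variable (S R : Type u) [Ring S] [Ring R] (C : Type u) [AddCommGroup C]
  [Module S C] [Module Rᵐᵒᵖ C] [SMulCommClass S Rᵐᵒᵖ C] (n : ℕ)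

/-- The `R`-module `M` is `C`-`fp_n`-injective: `M ≅ Hom_S(C, X)` as `R`-modules for some
`fp_n`-injective `S`-module `X`. -/
def IsCFpInjective (M : Type u) [AddCommGroup M] [Module R M] : Prop :=
  ∃ (X : Type u) (_ : AddCommGroup X) (_ : Module S X),
    IsFpInjective S n X ∧ Nonempty (M ≃ₗ[R] BimoduleHom S C X)

/-- The `S`-module `N` is `C`-`fp_n`-flat: `N ≅ C ⊗_R Y` as `S`-modules for some
`fp_n`-flat `R`-module `Y`. -/
def IsCFpFlat (N : Type u) [AddCommGroup N] [Module S N] : Prop :=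
  ∃ (Y : Type u) (_ : AddCommGroup Y) (_ : Module R Y),
    IsFpFlat R n Y ∧ Nonempty (N ≃ₗ[S] Tensor R C Y)

end Classes

/-- `M'` is a pure submodule of `M`: `0 → A ⊗_R M' → A ⊗_R M → A ⊗_R (M / M') → 0` is exact for
every right `R`-module `A`. -/
def IsPureSubmodule {R : Type u} [Ring R] {M : Type u} [AddCommGroup M] [Module R M]
    (M' : Submodule R M) : Prop :=
  ∀ (A : Type u) [AddCommGroup A] [Module Rᵐᵒᵖ A],
    Function.Injective (Tensor.map R (LinearMap.id : A →ₗ[Rᵐᵒᵖ] A) M'.subtype) ∧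
    Function.Exact (Tensor.map R (LinearMap.id : A →ₗ[Rᵐᵒᵖ] A) M'.subtype)
      (Tensor.map R (LinearMap.id : A →ₗ[Rᵐᵒᵖ] A) M'.mkQ) ∧
    Function.Surjective (Tensor.map R (LinearMap.id : A →ₗ[Rᵐᵒᵖ] A) M'.mkQ)

end CFp

/-! The proof is Foxby duality for the adjoint pair `C ⊗_R -` and `Hom_S(C, -)`. An `R`-module `M`
is `C`-`fp_n`-injective exactly when the unit `M → Hom_S(C, C ⊗_R M)` is bijective and `C ⊗_R M` is
`fp_n`-injective (`isCFpInjective_iff`); dually for `C`-`fp_n`-flat modules, the counit and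
`Hom_S(C, -)` (`isCFpFlat_iff`). These descriptions rest on the bijectivity of the unit on
`fp_n`-flat modules and of the counit on `fp_n`-injective ones. For the unit, a finite presentation
`S^p → S^q → C → 0` dualizes to an exact sequence `0 → R → C^q → C^p` of right modules, because `R =
End_S(C)`. Both `R → C^q` and the embedding of its cokernel into `C^p` are injections of finitely
`n`-presented modules, so `fp_n`-flatness applies to them. The counit is treated with the roles of
the rings exchanged.

It remains to see that each half of these descriptions passes through pure sequences. `C ⊗_R -` and
`Hom_S(C, -)` preserve purity (`isPureExact_tensor`, `BimoduleHom.isPureExact`). In a pure exact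
sequence the middle term is `fp_n`-injective, or `fp_n`-flat, if and only if both ends are; here `n
> 0` makes the test modules finitely presented. Bijectivity of the unit or counit descends to the
pure submodule by the same presentation argument, and diagram chases give the quotient and the
middle term. -/

namespace CFp

open scoped TensorProduct MulOpposite

/-! ### Tensor products over a noncommutative ring: right exactness, coordinates, unit isomorphisms.
-/

section TensorBasics

variable {R : Type u} [Ring R]
variable {A : Type u} [AddCommGroup A] [Module Rᵐᵒᵖ A]
variable {M : Type u} [AddCommGroup M] [Module R M]

namespace Tensor

theorem induction_on {p : Tensor R A M → Prop} (t : Tensor R A M) (zero : p 0)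
    (tmul : ∀ a m, p (Tensor.tmul R a m)) (add : ∀ x y, p x → p y → p (x + y)) : p t := by
  obtain ⟨t, rfl⟩ := QuotientAddGroup.mk_surjective t
  induction t with
  | zero => exact zero
  | tmul a m => exact tmul a m
  | add x y hx hy => exact add _ _ hx hy

theorem add_tmul (a b : A) (m : M) : tmul R (a + b) m = tmul R a m + tmul R b m :=
  congrArg (QuotientAddGroup.mk' _) (TensorProduct.add_tmul a b m)

theorem tmul_add (a : A) (m m' : M) : tmul R a (m + m') = tmul R a m + tmul R a m' :=
  congrArg (QuotientAddGroup.mk' _) (TensorProduct.tmul_add a m m')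

theorem op_smul_tmul (r : R) (a : A) (m : M) :
    tmul R (MulOpposite.op r • a) m = tmul R a (r • m) := by
  refine (QuotientAddGroup.eq_iff_sub_mem (N := balancedRel R A M)).2 ?_
  exact AddSubgroup.subset_closure ⟨a, r, m, rfl⟩

theorem smul_tmul (r : Rᵐᵒᵖ) (a : A) (m : M) :
    tmul R (r • a) m = tmul R a (r.unop • m) := op_smul_tmul r.unop a m

variable (R) in
/-- The biadditive map `(a, m) ↦ a ⊗ m`. -/
def mk : A →+ M →+ Tensor R A M :=
  AddMonoidHom.mk' (fun a => AddMonoidHom.mk' (tmul R a) (tmul_add a))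
    (fun a b => AddMonoidHom.ext (add_tmul a b))

theorem zero_tmul (m : M) : tmul R (0 : A) m = 0 := DFunLike.congr_fun (map_zero (mk R)) m

theorem tmul_zero (a : A) : tmul R a (0 : M) = 0 := map_zero (mk R a)

theorem sum_tmul {ι : Type*} (s : Finset ι) (a : ι → A) (m : M) :
    tmul R (∑ i ∈ s, a i) m = ∑ i ∈ s, tmul R (a i) m :=
  map_sum ((mk R).flip m) a s

theorem tmul_sum {ι : Type*} (s : Finset ι) (a : A) (m : ι → M) :
    tmul R a (∑ i ∈ s, m i) = ∑ i ∈ s, tmul R a (m i) :=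
  map_sum (mk R a) m s

/-- The universal property of `A ⊗_R M`. -/
def lift {P : Type*} [AddCommGroup P] (f : A →+ M →+ P)
    (hf : ∀ a (r : R) m, f (MulOpposite.op r • a) m = f a (r • m)) : Tensor R A M →+ P :=
  QuotientAddGroup.lift (balancedRel R A M)
    (TensorProduct.liftAddHom f (fun n a m => by simp)) (by
      rw [balancedRel, AddSubgroup.closure_le]
      rintro _ ⟨a, r, m, rfl⟩
      simp [hf])

theorem addHom_ext {P : Type*} [AddCommGroup P] {f g : Tensor R A M →+ P}
    (h : ∀ a m, f (tmul R a m) = g (tmul R a m)) (t : Tensor R A M) : f t = g t := by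
  induction t using Tensor.induction_on with
  | zero => simp
  | tmul a m => exact h a m
  | add x y hx hy => simp [hx, hy]

section Map

variable {A' A'' M' M'' : Type u} [AddCommGroup A'] [Module Rᵐᵒᵖ A'] [AddCommGroup M'] [Module R M']
  [AddCommGroup A''] [Module Rᵐᵒᵖ A''] [AddCommGroup M''] [Module R M'']

theorem map_map (f : A →ₗ[Rᵐᵒᵖ] A') (g : M →ₗ[R] M') (f' : A' →ₗ[Rᵐᵒᵖ] A'') (g' : M' →ₗ[R] M'')
    (t : Tensor R A M) :
    map R f' g' (map R f g t) = map R (f'.comp f) (g'.comp g) t :=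
  addHom_ext (f := (map R f' g').comp (map R f g)) (g := map R (f'.comp f) (g'.comp g))
    (fun _ _ => rfl) t

theorem map_id (t : Tensor R A M) :
    map R (LinearMap.id : A →ₗ[Rᵐᵒᵖ] A) (LinearMap.id : M →ₗ[R] M) t = t :=
  addHom_ext (f := map R LinearMap.id LinearMap.id) (g := AddMonoidHom.id _) (fun _ _ => rfl) t

theorem map_comm (f : A →ₗ[Rᵐᵒᵖ] A') (g : M →ₗ[R] M') (t : Tensor R A M) :
    map R LinearMap.id g (map R f LinearMap.id t) = map R f LinearMap.id (map R LinearMap.id g t) := by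
  rw [map_map, map_map]; rfl

theorem map_surjective {f : A →ₗ[Rᵐᵒᵖ] A'} {g : M →ₗ[R] M'} (hf : Function.Surjective f)
    (hg : Function.Surjective g) : Function.Surjective (map R f g) := by
  intro t
  induction t using Tensor.induction_on with
  | zero => exact ⟨0, map_zero _⟩
  | tmul a m =>
    obtain ⟨a, rfl⟩ := hf a
    obtain ⟨m, rfl⟩ := hg m
    exact ⟨tmul R a m, rfl⟩
  | add x y hx hy =>
    obtain ⟨x, rfl⟩ := hx
    obtain ⟨y, rfl⟩ := hy
    exact ⟨x + y, map_add _ _ _⟩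

/-- For surjective `f` and `g`, the kernel of `f ⊗ g` is generated by the `a ⊗ m` with `f a = 0`
or `g m = 0`. -/
theorem mem_of_map_eq_zero {f : A →ₗ[Rᵐᵒᵖ] A'} {g : M →ₗ[R] M'} (hf : Function.Surjective f)
    (hg : Function.Surjective g) (Q : AddSubgroup (Tensor R A M))
    (hQf : ∀ a m, f a = 0 → tmul R a m ∈ Q) (hQg : ∀ a m, g m = 0 → tmul R a m ∈ Q)
    {t : Tensor R A M} (ht : map R f g t = 0) : t ∈ Q := by
  have key : ∀ a b m m', f a = f b → g m = g m' →
      (QuotientAddGroup.mk' Q (tmul R a m)) = QuotientAddGroup.mk' Q (tmul R b m') := by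
    intro a b m m' hab hm
    rw [← sub_eq_zero, ← map_sub]
    refine (QuotientAddGroup.eq_zero_iff _).2 ?_
    have : tmul R a m - tmul R b m' = tmul R (a - b) m + tmul R b (m - m') := by
      have h1 := add_tmul (R := R) (a - b) b m
      have h2 := tmul_add (R := R) b (m - m') m'
      rw [sub_add_cancel] at h1 h2
      rw [h1, h2]; abel
    rw [this]
    exact Q.add_mem (hQf _ _ (by simp [hab])) (hQg _ _ (by simp [hm]))
  -- An inverse to `(A ⊗ M) / Q → A' ⊗ M'` is built from set-theoretic sections of `f` and `g`;
  -- `key` says that the class modulo `Q` does not depend on the lifts, which makes it biadditive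
  -- and balanced.
  let φ : A' →+ M' →+ (Tensor R A M ⧸ Q) :=
    AddMonoidHom.mk' (fun a => AddMonoidHom.mk'
      (fun m => QuotientAddGroup.mk' Q (tmul R (Function.surjInv hf a) (Function.surjInv hg m)))
      (fun m m' => by
        rw [← map_add, ← tmul_add]
        exact key _ _ _ _ rfl (by simp [Function.surjInv_eq])))
      (fun a b => by
        ext m
        simp only [AddMonoidHom.mk'_apply, AddMonoidHom.add_apply]
        rw [← map_add, ← add_tmul]
        exact key _ _ _ _ (by simp [Function.surjInv_eq]) rfl)
  have hφ : ∀ a (r : R) m, φ (MulOpposite.op r • a) m = φ a (r • m) := by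
    intro a r m
    refine (key _ (MulOpposite.op r • Function.surjInv hf a) _ (Function.surjInv hg m)
      (by simp [Function.surjInv_eq]) rfl).trans ?_
    rw [op_smul_tmul]
    exact key _ _ _ _ rfl (by simp [Function.surjInv_eq])
  have h : ∀ t, lift φ hφ (map R f g t) = QuotientAddGroup.mk' Q t :=
    addHom_ext (f := (lift φ hφ).comp (map R f g)) (fun a m =>
      key _ _ _ _ (Function.surjInv_eq hf _) (Function.surjInv_eq hg _))
  have := h t
  rw [ht, map_zero] at this
  exact (QuotientAddGroup.eq_zero_iff _).1 this.symm

theorem exact_map_left {f : A →ₗ[Rᵐᵒᵖ] A'} {f' : A' →ₗ[Rᵐᵒᵖ] A''} (h : Function.Exact f f')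
    (hf' : Function.Surjective f') :
    Function.Exact (map R f (LinearMap.id : M →ₗ[R] M)) (map R f' LinearMap.id) := by
  intro t
  constructor
  · intro ht
    refine mem_of_map_eq_zero hf' Function.surjective_id (map R f LinearMap.id).range ?_ ?_ ht
    · intro a m ha
      obtain ⟨a, rfl⟩ := (h a).1 ha
      exact ⟨tmul R a m, rfl⟩
    · rintro a m rfl
      rw [tmul_zero]
      exact zero_mem _
  · rintro ⟨t, rfl⟩
    rw [map_map]
    exact addHom_ext (g := 0) (fun a m => by
      simp [map_tmul, h.apply_apply_eq_zero, zero_tmul]) t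

theorem exact_map_right {g : M →ₗ[R] M'} {g' : M' →ₗ[R] M''} (h : Function.Exact g g')
    (hg' : Function.Surjective g') :
    Function.Exact (map R (LinearMap.id : A →ₗ[Rᵐᵒᵖ] A) g) (map R LinearMap.id g') := by
  intro t
  constructor
  · intro ht
    refine mem_of_map_eq_zero Function.surjective_id hg' (map R LinearMap.id g).range ?_ ?_ ht
    · rintro a m rfl
      rw [zero_tmul]
      exact zero_mem _
    · intro a m hm
      obtain ⟨m, rfl⟩ := (h m).1 hm
      exact ⟨tmul R a m, rfl⟩
  · rintro ⟨t, rfl⟩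
    rw [map_map]
    exact addHom_ext (g := 0) (fun a m => by
      simp [map_tmul, h.apply_apply_eq_zero, tmul_zero]) t

end Map

section Pi

variable {q : ℕ}

/-- The coordinates of an element of `A ^ q ⊗_R M`. -/
def coord (i : Fin q) : Tensor R (Fin q → A) M →+ Tensor R A M :=
  map R (LinearMap.proj i) LinearMap.id

/-- The element of `A ^ q ⊗_R M` with given coordinates. -/
def ofCoord (x : Fin q → Tensor R A M) : Tensor R (Fin q → A) M :=
  ∑ i, map R (LinearMap.single Rᵐᵒᵖ (fun _ => A) i) LinearMap.id (x i)

theorem coord_tmul (i : Fin q) (a : Fin q → A) (m : M) :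
    coord i (tmul R a m) = tmul R (a i) m := rfl

theorem coord_map_right {M' : Type u} [AddCommGroup M'] [Module R M'] (f : M →ₗ[R] M')
    (t : Tensor R (Fin q → A) M) (i : Fin q) :
    coord i (map R (LinearMap.id : (Fin q → A) →ₗ[Rᵐᵒᵖ] (Fin q → A)) f t)
      = map R (LinearMap.id : A →ₗ[Rᵐᵒᵖ] A) f (coord i t) := by
  induction t using Tensor.induction_on with
  | zero => simp
  | tmul a m => rw [map_tmul, coord_tmul, coord_tmul, map_tmul]; rfl
  | add x y hx hy => rw [map_add, map_add, map_add, map_add, hx, hy]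

theorem coord_ofCoord (x : Fin q → Tensor R A M) (i : Fin q) : coord i (ofCoord x) = x i := by
  have h : ∀ j (t : Tensor R A M),
      coord i (map R (LinearMap.single Rᵐᵒᵖ (fun _ => A) j) LinearMap.id t)
        = if j = i then t else 0 := by
    intro j t
    rw [coord, map_map]
    split_ifs with hij
    · subst hij
      exact addHom_ext (g := AddMonoidHom.id _) (fun a m => by simp [map_tmul]) t
    · exact addHom_ext (g := 0) (fun a m => by
        simp [map_tmul, Pi.single_eq_of_ne' hij, zero_tmul]) t
  simp [ofCoord, h]

theorem eq_of_coord_eq {s t : Tensor R (Fin q → A) M} (h : ∀ i, coord i s = coord i t) :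
    s = t := by
  have key : ∀ t : Tensor R (Fin q → A) M, ofCoord (fun i => coord i t) = t := by
    intro t
    induction t using Tensor.induction_on with
    | zero => simp [ofCoord]
    | tmul a m =>
      simp only [ofCoord, coord_tmul, map_tmul]
      rw [LinearMap.id_apply, ← sum_tmul]
      congr 1
      exact LinearMap.sum_single_apply _ _
    | add x y hx hy =>
      conv_rhs => rw [← hx, ← hy]
      simp [ofCoord, Finset.sum_add_distrib]
  rw [← key s, ← key t, funext h]

end Pi

/-- The isomorphism `R ⊗_R M → M`, with the free right module `R` realised as `Rᵐᵒᵖ`. -/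
def opLid : Tensor R Rᵐᵒᵖ M →+ M :=
  lift (AddMonoidHom.mk' (fun a => AddMonoidHom.mk' (fun m => a.unop • m) (smul_add _))
    (fun a b => AddMonoidHom.ext (fun m => add_smul a.unop b.unop m)))
    (fun a r m => mul_smul a.unop r m)

theorem opLid_tmul (a : Rᵐᵒᵖ) (m : M) : opLid (tmul R a m) = a.unop • m := rfl

theorem one_tmul_opLid (t : Tensor R Rᵐᵒᵖ M) : tmul R 1 (opLid t) = t :=
  addHom_ext (f := (mk R (1 : Rᵐᵒᵖ)).comp opLid) (g := AddMonoidHom.id _) (fun a m => by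
    change tmul R (1 : Rᵐᵒᵖ) (a.unop • m) = _
    rw [← smul_tmul, smul_eq_mul, mul_one]; rfl) t

/-- The isomorphism `R ⊗_R M → M`. -/
def lid : Tensor R R M →ₗ[R] M :=
  { lift (AddMonoidHom.mk' (fun a => AddMonoidHom.mk' (fun m => a • m) (smul_add _))
      (fun a b => AddMonoidHom.ext (fun m => add_smul a b m)))
      (fun a r m => mul_smul a r m) with
    map_smul' := fun r t => addHom_ext
      (f := (lift (AddMonoidHom.mk' (fun a => AddMonoidHom.mk' (fun m => a • m) (smul_add _))
        (fun a b => AddMonoidHom.ext (fun m => add_smul a b m)))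
        (fun a r m => mul_smul a r m)).comp (leftAction R R R M r))
      (g := (DistribSMul.toAddMonoidHom M r).comp
        (lift (AddMonoidHom.mk' (fun a => AddMonoidHom.mk' (fun m => a • m) (smul_add _))
        (fun a b => AddMonoidHom.ext (fun m => add_smul a b m)))
        (fun a r m => mul_smul a r m)))
      (fun a m => mul_smul r a m) t }

theorem lid_tmul (a : R) (m : M) : lid (tmul R a m) = a • m := rfl

end Tensor

end TensorBasics

/-! ### Finite presentations by generators and relation matrices. -/

section Presentations

variable {R : Type u} [Ring R] {M : Type u} [AddCommGroup M] [Module R M]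

/-- The elements `e i` generate `M`, and the rows `r j` generate the relations between them. -/
structure IsPresentation {p q : ℕ} (e : Fin q → M) (r : Fin p → Fin q → R) : Prop where
  exists_sum_eq : ∀ m, ∃ a : Fin q → R, ∑ i, a i • e i = m
  relation : ∀ j, ∑ i, r j i • e i = 0
  exists_of_sum_eq_zero : ∀ a : Fin q → R, ∑ i, a i • e i = 0 →
    ∃ b : Fin p → R, ∀ i, a i = ∑ j, b j * r j i

theorem exists_isPresentation [Module.FinitePresentation R M] :
    ∃ (q p : ℕ) (e : Fin q → M) (r : Fin p → Fin q → R), IsPresentation e r := by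
  obtain ⟨q, p, f, g, hf, hg⟩ := Module.FinitePresentation.exists_fin' R M
  have single : ∀ {k : ℕ} {P : Type u} [AddCommGroup P] [Module R P] (h : (Fin k → R) →ₗ[R] P)
      (a : Fin k → R), h a = ∑ i, a i • h (Pi.single i 1) := by
    intro k P _ _ h a
    have := LinearMap.sum_single_apply (fun _ : Fin k => R) a
    conv_lhs => rw [← this, map_sum]
    refine Finset.sum_congr rfl fun i _ => ?_
    rw [← map_smul, ← Pi.single_smul, smul_eq_mul, mul_one]
  have hfe := single f
  have hge := single g
  refine ⟨q, p, fun i => f (Pi.single i 1), fun j => g (Pi.single j 1), ?_, ?_, ?_⟩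
  · intro m
    obtain ⟨a, rfl⟩ := hf m
    exact ⟨a, (hfe a).symm⟩
  · intro j
    rw [← hfe, hg.apply_apply_eq_zero]
  · intro a ha
    rw [← hfe] at ha
    obtain ⟨b, rfl⟩ := (hg a).1 ha
    refine ⟨b, fun i => ?_⟩
    rw [hge]
    simp

theorem IsPresentation.exists_lift {p q : ℕ} {e : Fin q → M} {r : Fin p → Fin q → R}
    (h : IsPresentation e r) {N : Type u} [AddCommGroup N] [Module R N] (x : Fin q → N)
    (hx : ∀ j, ∑ i, r j i • x i = 0) : ∃ ψ : M →ₗ[R] N, ∀ i, ψ (e i) = x i := by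
  have hs : Function.Surjective (Fintype.linearCombination R e) := h.exists_sum_eq
  have hk : LinearMap.ker (Fintype.linearCombination R e)
      ≤ LinearMap.ker (Fintype.linearCombination R x) := by
    intro a ha
    obtain ⟨b, hb⟩ := h.exists_of_sum_eq_zero a ha
    change ∑ i, a i • x i = 0
    simp only [hb, Finset.sum_smul, mul_smul]
    rw [Finset.sum_comm]
    simp [← Finset.smul_sum, hx]
  refine ⟨(Submodule.liftQ _ _ hk).comp
    (LinearMap.quotKerEquivOfSurjective _ hs).symm.toLinearMap, fun i => ?_⟩
  have : e i = Fintype.linearCombination R e (Pi.single i 1) := by simp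
  rw [LinearMap.comp_apply, LinearEquiv.coe_coe, this,
    LinearMap.quotKerEquivOfSurjective_symm_apply]
  simp

theorem IsPresentation.hom_ext {p q : ℕ} {e : Fin q → M} {r : Fin p → Fin q → R}
    (h : IsPresentation e r) {N : Type u} [AddCommGroup N] [Module R N] {f g : M →ₗ[R] N}
    (hfg : ∀ i, f (e i) = g (e i)) : f = g := by
  ext m
  obtain ⟨a, rfl⟩ := h.exists_sum_eq m
  simp [hfg]

end Presentations

/-! ### Closure properties of finitely `n`-presented modules. -/

section NPresented

variable (R : Type u) [Ring R]

/-- The recursive form of being finitely `n`-presented: `M` is finitely generated and, for `n > 0`,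
has a finitely `(n - 1)`-presented first syzygy. -/
def IsFP : ℕ → ∀ (M : Type u) [AddCommGroup M] [Module R M], Prop
  | 0, M, _, _ => ∃ (k : ℕ) (ε : (Fin k → R) →ₗ[R] M), Function.Surjective ε
  | n + 1, M, _, _ => ∃ (k : ℕ) (ε : (Fin k → R) →ₗ[R] M), Function.Surjective ε ∧
      IsFP n (LinearMap.ker ε)

variable {R}
variable {M N : Type u} [AddCommGroup M] [Module R M] [AddCommGroup N] [Module R N]

theorem IsFP.finitelyNPresented {n : ℕ} (h : IsFP R n M) : FinitelyNPresented R M n := by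
  induction n generalizing M with
  | zero =>
    obtain ⟨k, ε, hε⟩ := h
    exact ⟨fun _ => k, ε, fun _ => 0, hε, by omega, by omega⟩
  | succ n ih =>
    obtain ⟨k, ε, hε, h⟩ := h
    obtain ⟨k', ε', d', hε', h0, hd⟩ := ih h
    refine ⟨fun i => Nat.casesOn i k k', ε, fun i => match i with
      | 0 => (LinearMap.ker ε).subtype.comp ε'
      | i + 1 => d' i, hε, ?_, ?_⟩
    · intro _ a
      constructor
      · intro ha
        obtain ⟨b, hb⟩ := hε' ⟨a, ha⟩
        exact ⟨b, congrArg Subtype.val hb⟩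
      · rintro ⟨b, rfl⟩
        exact (ε' b).2
    · rintro (_ | i) hi
      · intro a
        refine Iff.trans ?_ (h0 (by omega) a)
        change (ε' a : Fin k → R) = 0 ↔ _
        rw [Submodule.coe_eq_zero]
      · exact hd i (by omega)

/-- Deleting `F_0` from the resolution leaves a resolution of the first syzygy, so the induction
runs over all modules at once. -/
theorem HasDegreewiseFiniteResolution.isFP (h : HasDegreewiseFiniteResolution R M) (n : ℕ) :
    IsFP R n M := by
  induction n generalizing M with
  | zero =>
    obtain ⟨k, ε, -, hε, -⟩ := h
    exact ⟨_, ε, hε⟩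
  | succ n ih =>
    obtain ⟨k, ε, d, hε, h0, hd⟩ := h
    refine ⟨_, ε, hε, ih ⟨fun i => k (i + 1),
      (d 0).codRestrict _ (fun x => h0.apply_apply_eq_zero x), fun i => d (i + 1), ?_, ?_,
      fun i => hd (i + 1)⟩⟩
    · rintro ⟨a, ha⟩
      obtain ⟨b, rfl⟩ := (h0 a).1 ha
      exact ⟨b, rfl⟩
    · intro a
      refine Iff.trans ?_ (hd 0 a)
      exact Subtype.ext_iff

theorem FinitelyNPresented.finitePresentation {n : ℕ} (h : FinitelyNPresented R M n) (hn : 0 < n) :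
    Module.FinitePresentation R M := by
  obtain ⟨k, ε, d, hε, h0, -⟩ := h
  refine Module.finitePresentation_of_free_of_surjective ε hε ?_
  rw [LinearMap.exact_iff.1 (h0 hn)]
  exact (Module.Finite.fg_top).map (d 0) |> fun h => by rwa [Submodule.map_top] at h

theorem IsFP.of_equiv {n : ℕ} (h : IsFP R n M) (e : M ≃ₗ[R] N) : IsFP R n N := by
  cases n with
  | zero =>
    obtain ⟨k, ε, hε⟩ := h
    exact ⟨k, e.toLinearMap.comp ε, e.surjective.comp hε⟩
  | succ n =>
    obtain ⟨k, ε, hε, h⟩ := h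
    refine ⟨k, e.toLinearMap.comp ε, e.surjective.comp hε, ?_⟩
    rwa [LinearEquiv.ker_comp]

theorem IsFP.of_subsingleton [Subsingleton M] (n : ℕ) : IsFP R n M := by
  induction n generalizing M with
  | zero => exact ⟨0, 0, fun m => ⟨0, Subsingleton.elim _ _⟩⟩
  | succ n ih => exact ⟨0, 0, fun m => ⟨0, Subsingleton.elim _ _⟩, ih⟩

theorem IsFP.free (n k : ℕ) : IsFP R n (Fin k → R) := by
  cases n with
  | zero => exact ⟨k, LinearMap.id, Function.surjective_id⟩
  | succ n =>
    refine ⟨k, LinearMap.id, Function.surjective_id, ?_⟩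
    rw [LinearMap.ker_id]
    exact IsFP.of_subsingleton n

theorem IsFP.self (n : ℕ) : IsFP R n R :=
  (IsFP.free n 1).of_equiv (LinearEquiv.funUnique (Fin 1) R R)

theorem IsFP.prod {n : ℕ} (hM : IsFP R n M) (hN : IsFP R n N) : IsFP R n (M × N) := by
  induction n generalizing M N with
  | zero =>
    obtain ⟨k, ε, hε⟩ := hM
    obtain ⟨l, δ, hδ⟩ := hN
    refine ⟨k + l, (ε.prodMap δ).comp ((LinearEquiv.funCongrLeft R R finSumFinEquiv).trans
      (LinearEquiv.sumArrowLequivProdArrow _ _ R R)).toLinearMap, ?_⟩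
    exact (hε.prodMap hδ).comp (LinearEquiv.surjective _)
  | succ n ih =>
    obtain ⟨k, ε, hε, hM⟩ := hM
    obtain ⟨l, δ, hδ, hN⟩ := hN
    let e := (LinearEquiv.funCongrLeft R R finSumFinEquiv).trans
      (LinearEquiv.sumArrowLequivProdArrow (Fin k) (Fin l) R R)
    refine ⟨k + l, (ε.prodMap δ).comp e.toLinearMap,
      (hε.prodMap hδ).comp e.surjective, (ih hM hN).of_equiv ?_⟩
    let e' : (LinearMap.ker ε × LinearMap.ker δ) ≃ₗ[R] LinearMap.ker (ε.prodMap δ) :=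
      { toFun := fun x => ⟨(x.1, x.2), Prod.ext x.1.2 x.2.2⟩
        invFun := fun x => (⟨x.1.1, congrArg Prod.fst x.2⟩, ⟨x.1.2, congrArg Prod.snd x.2⟩)
        map_add' := fun _ _ => rfl
        map_smul' := fun _ _ => rfl
        left_inv := fun _ => rfl
        right_inv := fun _ => rfl }
    exact e'.trans (LinearEquiv.ofSubmodule' e (LinearMap.ker (ε.prodMap δ))).symm

theorem IsFP.pi {n : ℕ} (h : IsFP R n M) (q : ℕ) : IsFP R n (Fin q → M) := by
  induction q with
  | zero => exact IsFP.of_subsingleton n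
  | succ q ih => exact (h.prod ih).of_equiv (Fin.consLinearEquiv R (fun _ => M))

/-- The cokernel of an injective map from the ring to a finitely `(n + 1)`-presented module. -/
theorem IsFP.quotient_range {n : ℕ} (h : IsFP R (n + 1) M) (u : R →ₗ[R] M)
    (hu : Function.Injective u) : IsFP R (n + 1) (M ⧸ LinearMap.range u) := by
  obtain ⟨k, ε, hε, h⟩ := h
  -- With `v` a lift of `u 1`, the kernel of `R^k → M / range u` is `ker ε + R v`. Injectivity of
  -- `u` makes this sum direct and `v` a free generator, so the new syzygy is `ker ε × R`.
  obtain ⟨v, hv⟩ := hε (u 1)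
  refine ⟨k, (LinearMap.range u).mkQ.comp ε, (Submodule.mkQ_surjective _).comp hε,
    (h.prod (IsFP.self n)).of_equiv ?_⟩
  have hεv : ∀ r : R, ε (r • v) = u r := fun r => by
    rw [map_smul, hv, ← map_smul, smul_eq_mul, mul_one]
  refine LinearEquiv.ofBijective (LinearMap.codRestrict _
    (LinearMap.coprod (LinearMap.ker ε).subtype (LinearMap.toSpanSingleton R _ v)) ?_) ⟨?_, ?_⟩
  · rintro ⟨⟨a, ha⟩, r⟩
    simp only [LinearMap.mem_ker, LinearMap.comp_apply, Submodule.mkQ_apply,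
      Submodule.Quotient.mk_eq_zero]
    refine ⟨r, ?_⟩
    rw [LinearMap.mem_ker] at ha
    simp [hεv, ha]
  · rw [← LinearMap.ker_eq_bot, LinearMap.ker_eq_bot']
    rintro ⟨⟨a, ha⟩, r⟩ h
    have h : a + r • v = 0 := congrArg Subtype.val h
    rw [LinearMap.mem_ker] at ha
    have h2 := congrArg ε h
    rw [map_add, ha, hεv, zero_add, map_zero, ← map_zero u] at h2
    have h3 := hu h2
    subst h3
    simpa using h
  · rintro ⟨a, ha⟩
    rw [LinearMap.mem_ker, LinearMap.comp_apply, Submodule.mkQ_apply,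
      Submodule.Quotient.mk_eq_zero] at ha
    obtain ⟨r, hr⟩ := ha
    refine ⟨⟨⟨a - r • v, ?_⟩, r⟩, ?_⟩
    · rw [LinearMap.mem_ker, map_sub, hεv, hr, sub_self]
    · exact Subtype.ext (sub_add_cancel _ _)

end NPresented

/-! ### Invariance of `fp_n`-injectivity and `fp_n`-flatness under isomorphism. -/

section Iso

variable {R : Type u} [Ring R] {M N : Type u} [AddCommGroup M] [Module R M]
  [AddCommGroup N] [Module R N] {n : ℕ}

theorem IsFpInjective.of_equiv (h : IsFpInjective R n M) (e : M ≃ₗ[R] N) :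
    IsFpInjective R n N := by
  intro K L _ _ _ _ f hK hL hf g
  obtain ⟨g', hg'⟩ := h K L f hK hL hf (e.symm.toLinearMap.comp g)
  refine ⟨e.toLinearMap.comp g', LinearMap.ext fun x => ?_⟩
  have : g' (f x) = e.symm (g x) := LinearMap.congr_fun hg' x
  simp [this]

theorem IsFpFlat.of_equiv (h : IsFpFlat R n M) (e : M ≃ₗ[R] N) : IsFpFlat R n N := by
  intro K L _ _ _ _ f hK hL hf
  rw [injective_iff_map_eq_zero]
  intro t ht
  have h0 : Tensor.map R (LinearMap.id : K →ₗ[Rᵐᵒᵖ] K) e.symm.toLinearMap t = 0 := by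
    apply h K L f hK hL hf
    rw [← Tensor.map_comm, ht, map_zero, map_zero]
  have h1 := congrArg (Tensor.map R (LinearMap.id : K →ₗ[Rᵐᵒᵖ] K) e.toLinearMap) h0
  rw [Tensor.map_map, map_zero] at h1
  rw [← h1]
  refine (Tensor.map_id t).symm.trans ?_
  congr 2
  ext; simp

end Iso

/-! ### Pure exact sequences and their effect on `fp_n`-injective and `fp_n`-flat modules. -/

section PureExact

variable {R : Type u} [Ring R]
variable {M' M M'' : Type u} [AddCommGroup M'] [Module R M'] [AddCommGroup M] [Module R M]
  [AddCommGroup M''] [Module R M'']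

/-- `0 → M' → M → M'' → 0` is exact, and every map from a finitely presented module to `M''`
lifts to `M`. -/
structure IsPureExact (f : M' →ₗ[R] M) (g : M →ₗ[R] M'') : Prop where
  injective : Function.Injective f
  exact : Function.Exact f g
  surjective : Function.Surjective g
  exists_lift : ∀ (K : Type u) [AddCommGroup K] [Module R K], Module.FinitePresentation R K →
    ∀ φ : K →ₗ[R] M'', ∃ ψ : K →ₗ[R] M, g.comp ψ = φ

namespace IsPureExact

variable {f : M' →ₗ[R] M} {g : M →ₗ[R] M''}

theorem exists_factor (h : IsPureExact f g) {K : Type u} [AddCommGroup K] [Module R K]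
    (φ : K →ₗ[R] M) (hφ : ∀ x, g (φ x) = 0) : ∃ ψ : K →ₗ[R] M', ∀ x, f (ψ x) = φ x := by
  refine ⟨(LinearEquiv.ofInjective f h.injective).symm.toLinearMap.comp
    (φ.codRestrict (LinearMap.range f) fun x => (h.exact _).1 (hφ x)), fun x => ?_⟩
  exact congrArg Subtype.val ((LinearEquiv.ofInjective f h.injective).apply_symm_apply _)

/-- Maps to the middle term that send a submodule with finitely presented quotient to `M'` can be
corrected to maps into `M'`. -/
theorem exists_extend (h : IsPureExact f g) {K L : Type u} [AddCommGroup K] [Module R K]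
    [AddCommGroup L] [Module R L] (k : K →ₗ[R] L)
    (hD : Module.FinitePresentation R (L ⧸ LinearMap.range k))
    (φ : K →ₗ[R] M') (ψ : L →ₗ[R] M) (hψ : ∀ x, ψ (k x) = f (φ x)) :
    ∃ χ : L →ₗ[R] M', ∀ x, χ (k x) = φ x := by
  have hk : LinearMap.range k ≤ LinearMap.ker (g.comp ψ) := by
    rintro _ ⟨x, rfl⟩
    simp [hψ, h.exact.apply_apply_eq_zero]
  -- `g ∘ ψ` factors through the cokernel of `k`. Subtracting from `ψ` a lift `θ` of the factored
  -- map pushes `ψ` into `M'` without changing it on the image of `k`.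
  obtain ⟨θ, hθ⟩ := h.exists_lift _ hD ((LinearMap.range k).liftQ (g.comp ψ) hk)
  have hθ' : ∀ y, g (θ ((LinearMap.range k).mkQ y)) = g (ψ y) := fun y =>
    LinearMap.congr_fun hθ ((LinearMap.range k).mkQ y)
  obtain ⟨χ, hχ⟩ := h.exists_factor (ψ - θ.comp (LinearMap.range k).mkQ) (fun y => by
    rw [LinearMap.sub_apply, map_sub, LinearMap.comp_apply, hθ', sub_self])
  refine ⟨χ, fun x => h.injective ?_⟩
  have : (LinearMap.range k).mkQ (k x) = 0 := by
    simp
  rw [hχ, LinearMap.sub_apply, LinearMap.comp_apply, this, map_zero, sub_zero, hψ]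

theorem _root_.CFp.finitePresentation_quotient_range {K L : Type u} [AddCommGroup K] [Module R K]
    [AddCommGroup L] [Module R L] (k : K →ₗ[R] L) [Module.Finite R K]
    [Module.FinitePresentation R L] : Module.FinitePresentation R (L ⧸ LinearMap.range k) := by
  refine Module.finitePresentation_of_surjective (LinearMap.range k).mkQ
    (Submodule.mkQ_surjective _) ?_
  rw [Submodule.ker_mkQ, LinearMap.range_eq_map]
  exact Module.Finite.fg_top.map k

/-- For `M'`, extend into `M` and correct by `exists_extend`. For `M''`, lift the map on `K` to `M`
and extend there. For `M`, extend the image in `M''`, lift the extension to `M`, and extend the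
resulting error, which takes values in `M'`. -/
theorem isFpInjective_iff (h : IsPureExact f g) {n : ℕ} (hn : 0 < n) :
    IsFpInjective R n M ↔ IsFpInjective R n M' ∧ IsFpInjective R n M'' := by
  refine ⟨fun hM => ⟨?_, ?_⟩, fun ⟨hM', hM''⟩ => ?_⟩
  · intro K L _ _ _ _ k hK hL hk φ
    have := hK.finitePresentation hn
    have := hL.finitePresentation hn
    obtain ⟨ψ, hψ⟩ := hM K L k hK hL hk (f.comp φ)
    obtain ⟨χ, hχ⟩ := h.exists_extend k (finitePresentation_quotient_range k) φ ψ
      (LinearMap.congr_fun hψ)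
    exact ⟨χ, LinearMap.ext hχ⟩
  · intro K L _ _ _ _ k hK hL hk φ
    obtain ⟨φ', rfl⟩ := h.exists_lift K (hK.finitePresentation hn) φ
    obtain ⟨ψ, rfl⟩ := hM K L k hK hL hk φ'
    exact ⟨g.comp ψ, rfl⟩
  · intro K L _ _ _ _ k hK hL hk φ
    obtain ⟨ψ'', hψ''⟩ := hM'' K L k hK hL hk (g.comp φ)
    obtain ⟨ψ, rfl⟩ := h.exists_lift L (hL.finitePresentation hn) ψ''
    obtain ⟨φ', hφ'⟩ := h.exists_factor (φ - ψ.comp k) (fun x => by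
      have : g (ψ (k x)) = g (φ x) := LinearMap.congr_fun hψ'' x
      simp [this])
    obtain ⟨ψ', rfl⟩ := hM' K L k hK hL hk φ'
    refine ⟨ψ + f.comp ψ', LinearMap.ext fun x => ?_⟩
    have : f (ψ' (k x)) = φ x - ψ (k x) := hφ' x
    simp [this]

/-- Lifting of maps from finitely presented modules is solvability of finite linear systems. -/
theorem of_systems (hf : Function.Injective f) (hfg : Function.Exact f g)
    (hg : Function.Surjective g)
    (H : ∀ (p q : ℕ) (r : Fin p → Fin q → R) (x : Fin q → M) (y : Fin p → M'),
      (∀ j, ∑ i, r j i • x i = f (y j)) → ∃ x' : Fin q → M', ∀ j, ∑ i, r j i • x' i = y j) :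
    IsPureExact f g := by
  refine ⟨hf, hfg, hg, fun K _ _ _ φ => ?_⟩
  obtain ⟨q, p, e, r, her⟩ := exists_isPresentation (R := R) (M := K)
  -- Arbitrary lifts `x i` of the images of the generators violate the relations only by elements `y
  -- j` of `M'`; a solution `x'` of the system in `M'` with right-hand side `y` is the correction
  -- needed.
  choose x hx using fun i => hg (φ (e i))
  have hy : ∀ j, ∃ y, f y = ∑ i, r j i • x i := fun j => by
    refine (hfg _).1 ?_
    simp_rw [map_sum, map_smul, hx, ← map_smul, ← map_sum, her.relation, map_zero]
  choose y hy using hy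
  obtain ⟨x', hx'⟩ := H p q r x y (fun j => (hy j).symm)
  obtain ⟨ψ, hψ⟩ := her.exists_lift (fun i => x i - f (x' i)) (fun j => by
    simp_rw [smul_sub, Finset.sum_sub_distrib, ← map_smul, ← map_sum, hx', hy, sub_self])
  refine ⟨ψ, her.hom_ext fun i => ?_⟩
  simp [hψ, hx, hfg.apply_apply_eq_zero]

/-- Converse to `of_systems`: a solution is an extension along the matrix map `R^p → R^q`, whose
cokernel is finitely presented, so `exists_extend` moves it from `M` to `M'`. -/
theorem exists_system (h : IsPureExact f g) {p q : ℕ} (r : Fin p → Fin q → R) (x : Fin q → M)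
    (y : Fin p → M') (hxy : ∀ j, ∑ i, r j i • x i = f (y j)) :
    ∃ x' : Fin q → M', ∀ j, ∑ i, r j i • x' i = y j := by
  let k : (Fin p → R) →ₗ[R] (Fin q → R) := Fintype.linearCombination R r
  obtain ⟨χ, hχ⟩ := h.exists_extend k (finitePresentation_quotient_range k)
    (Fintype.linearCombination R y) (Fintype.linearCombination R x) (fun a => by
      simp only [k, Fintype.linearCombination_apply, map_sum, map_smul, ← hxy, Finset.smul_sum,
        smul_smul])
  refine ⟨fun i => χ (Pi.single i 1), fun j => ?_⟩
  have h1 : k (Pi.single j 1) = r j := by simp [k]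
  have h2 := hχ (Pi.single j 1)
  rw [h1] at h2
  rw [show y j = Fintype.linearCombination R y (Pi.single j 1) by simp, ← h2]
  conv_rhs => rw [← LinearMap.sum_single_apply (fun _ : Fin q => R) (r j), map_sum]
  refine Finset.sum_congr rfl fun i _ => ?_
  rw [← map_smul, ← Pi.single_smul, smul_eq_mul, mul_one]

/-- Tensoring with a finitely presented right module preserves the injectivity of `f`. -/
theorem tensor_injective (h : IsPureExact f g) {A : Type u} [AddCommGroup A] [Module Rᵐᵒᵖ A]
    [Module.FinitePresentation Rᵐᵒᵖ A] :
    Function.Injective (Tensor.map R (LinearMap.id : A →ₗ[Rᵐᵒᵖ] A) f) := by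
  obtain ⟨q, p, e, r, her⟩ := exists_isPresentation (R := Rᵐᵒᵖ) (M := A)
  let π : (Fin q → Rᵐᵒᵖ) →ₗ[Rᵐᵒᵖ] A := Fintype.linearCombination Rᵐᵒᵖ e
  let k : (Fin p → Rᵐᵒᵖ) →ₗ[Rᵐᵒᵖ] (Fin q → Rᵐᵒᵖ) := Fintype.linearCombination Rᵐᵒᵖ r
  have hπ : Function.Surjective π := her.exists_sum_eq
  have hk : Function.Exact k π := by
    intro a
    constructor
    · intro ha
      obtain ⟨b, hb⟩ := her.exists_of_sum_eq_zero a ha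
      refine ⟨b, funext fun i => ?_⟩
      simp [k, Fintype.linearCombination_apply, hb]
    · rintro ⟨b, rfl⟩
      simp only [π, k, Fintype.linearCombination_apply, Finset.sum_apply, Pi.smul_apply,
        Finset.sum_smul, smul_eq_mul, mul_smul]
      rw [Finset.sum_comm]
      simp [← Finset.smul_sum, her.relation]
  have hk1 : ∀ {P : Type u} [AddCommGroup P] [Module R P] (t : Tensor R (Fin p → Rᵐᵒᵖ) P) (i),
      Tensor.opLid (Tensor.coord i (Tensor.map R k LinearMap.id t))
        = ∑ j, (r j i).unop • Tensor.opLid (Tensor.coord j t) := by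
    intro P _ _ t i
    induction t using Tensor.induction_on with
    | zero => simp
    | tmul a m =>
      simp [Tensor.map_tmul, Tensor.coord_tmul, Tensor.opLid_tmul, k,
        Fintype.linearCombination_apply, Finset.sum_smul, mul_smul]
    | add x y hx hy => simp [hx, hy, smul_add, Finset.sum_add_distrib]
  have hnat : ∀ t : Tensor R (Fin q → Rᵐᵒᵖ) M', ∀ i,
      Tensor.opLid (Tensor.coord i (Tensor.map R LinearMap.id f t))
        = f (Tensor.opLid (Tensor.coord i t)) := fun t i =>
    Tensor.addHom_ext
      (f := (Tensor.opLid.comp (Tensor.coord i)).comp (Tensor.map R LinearMap.id f))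
      (g := (f.toAddMonoidHom.comp Tensor.opLid).comp (Tensor.coord i)) (fun a m => by
        simp [Tensor.map_tmul, Tensor.coord_tmul, Tensor.opLid_tmul]) t
  have hinj : ∀ {P : Type u} [AddCommGroup P] [Module R P] (s t : Tensor R (Fin q → Rᵐᵒᵖ) P),
      (∀ i, Tensor.opLid (Tensor.coord i s) = Tensor.opLid (Tensor.coord i t)) → s = t := by
    intro P _ _ s t hst
    refine Tensor.eq_of_coord_eq fun i => ?_
    rw [← Tensor.one_tmul_opLid (Tensor.coord i s), hst, Tensor.one_tmul_opLid]
  rw [injective_iff_map_eq_zero]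
  intro t ht
  obtain ⟨t, rfl⟩ := Tensor.map_surjective (R := R) (g := (LinearMap.id : M' →ₗ[R] M')) hπ
    Function.surjective_id t
  rw [Tensor.map_comm] at ht
  obtain ⟨s, hs⟩ := (Tensor.exact_map_left hk hπ _).1 ht
  -- An element of `A ⊗ M'` is a tuple in `M'^q`, and it dies in `A ⊗ M` when the relation matrix
  -- hits it from `M^p`. This is a system over `M` with right-hand side in `M'`, in the transposed
  -- matrix, and purity solves it in `M'`.
  obtain ⟨x', hx'⟩ := h.exists_system (fun i j => (r j i).unop)
    (fun j => Tensor.opLid (Tensor.coord j s)) (fun i => Tensor.opLid (Tensor.coord i t))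
    (fun i => by rw [← hk1, hs, hnat])
  refine (Tensor.exact_map_left hk hπ _).2
    ⟨Tensor.ofCoord fun j => Tensor.tmul R 1 (x' j), hinj _ _ fun i => ?_⟩
  rw [hk1, ← hx']
  simp [Tensor.coord_ofCoord, Tensor.opLid_tmul]

/-- Each implication is a chase in the diagram of `K ⊗ -` and `L ⊗ -` applied to the sequence, with
`tensor_injective` used at `K`, at the cokernel of `k`, and at `L` respectively. -/
theorem isFpFlat_iff (h : IsPureExact f g) {n : ℕ} (hn : 0 < n) :
    IsFpFlat R n M ↔ IsFpFlat R n M' ∧ IsFpFlat R n M'' := by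
  refine ⟨fun hM => ⟨?_, ?_⟩, fun ⟨hM', hM''⟩ => ?_⟩
  · intro K L _ _ _ _ k hK hL hk
    have := hK.finitePresentation hn
    have := (hM K L k hK hL hk).comp (h.tensor_injective (A := K))
    refine Function.Injective.of_comp
      (f := Tensor.map R (LinearMap.id : L →ₗ[Rᵐᵒᵖ] L) f) ?_
    intro s t hst
    refine this ?_
    simpa only [Function.comp_apply, Tensor.map_comm] using hst
  · intro K L _ _ _ _ k hK hL hk
    rw [injective_iff_map_eq_zero]
    intro t ht
    have := hK.finitePresentation hn
    have := hL.finitePresentation hn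
    have := finitePresentation_quotient_range k
    have hex : Function.Exact k (LinearMap.range k).mkQ := LinearMap.exact_map_mkQ_range k
    obtain ⟨t, rfl⟩ := Tensor.map_surjective (R := R) (f := (LinearMap.id : K →ₗ[Rᵐᵒᵖ] K))
      Function.surjective_id h.surjective t
    rw [← Tensor.map_comm] at ht
    obtain ⟨s, hs⟩ := (Tensor.exact_map_right h.exact h.surjective _).1 ht
    -- The image of `s` in `L ⊗ M` comes from `K ⊗ M`, so it vanishes in `coker k ⊗ M`, into which
    -- `coker k ⊗ M'` injects.
    have hs0 : Tensor.map R (LinearMap.range k).mkQ LinearMap.id s = 0 := by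
      refine (injective_iff_map_eq_zero _).1 (h.tensor_injective (A := L ⧸ LinearMap.range k)) _ ?_
      rw [Tensor.map_comm, hs]
      exact (Tensor.exact_map_left hex (Submodule.mkQ_surjective _) _).2 ⟨t, rfl⟩
    obtain ⟨s, rfl⟩ := (Tensor.exact_map_left hex (Submodule.mkQ_surjective _) _).1 hs0
    rw [Tensor.map_comm] at hs
    rw [← hM K L k hK hL hk hs]
    exact (Tensor.exact_map_right h.exact h.surjective _).2 ⟨s, rfl⟩
  · intro K L _ _ _ _ k hK hL hk
    rw [injective_iff_map_eq_zero]
    intro t ht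
    have := hL.finitePresentation hn
    have h0 : Tensor.map R LinearMap.id g t = 0 := by
      refine (injective_iff_map_eq_zero _).1 (hM'' K L k hK hL hk) _ ?_
      rw [← Tensor.map_comm, ht, map_zero]
    obtain ⟨t, rfl⟩ := (Tensor.exact_map_right h.exact h.surjective _).1 h0
    rw [← Tensor.map_comm] at ht
    rw [(injective_iff_map_eq_zero _).1 (hM' K L k hK hL hk) _
      ((injective_iff_map_eq_zero _).1 h.tensor_injective _ ht), map_zero]

end IsPureExact

end PureExact

/-! ### The exact sequence `0 → T → C^q → C^p` attached to a presentation of `C`. -/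

section Rows

variable {S T : Type u} [Ring S] [Ring T] {C : Type u} [AddCommGroup C] [Module S C] [Module T C]
  [SMulCommClass S T C] {p q : ℕ}

variable (T C) in
/-- The map `C ^ q → C ^ p` given by a matrix over `S`, linear for the commuting action of `T`. -/
def rowMap (s : Fin p → Fin q → S) : (Fin q → C) →ₗ[T] (Fin p → C) where
  toFun x j := ∑ i, s j i • x i
  map_add' x y := funext fun j => by simp [Finset.sum_add_distrib]
  map_smul' t x := funext fun j => by
    simp only [Pi.smul_apply, RingHom.id_apply, Finset.smul_sum]
    exact Finset.sum_congr rfl fun i _ => smul_comm _ _ _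

theorem rowMap_apply (s : Fin p → Fin q → S) (x : Fin q → C) (j : Fin p) :
    rowMap T C s x j = ∑ i, s j i • x i := rfl

variable (S T C) in
/-- The homothety map `T → End_S(C)` is bijective. -/
structure HomothetyBijective : Prop where
  eq_zero : ∀ t : T, (∀ c : C, t • c = 0) → t = 0
  exists_eq : ∀ φ : C →ₗ[S] C, ∃ t : T, ∀ c, φ c = t • c

variable {c : Fin q → C} {s : Fin p → Fin q → S}

theorem HomothetyBijective.injective (hT : HomothetyBijective S T C) (h : IsPresentation c s) :
    Function.Injective (LinearMap.toSpanSingleton T (Fin q → C) c) := by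
  rw [injective_iff_map_eq_zero]
  intro t ht
  refine hT.eq_zero t fun x => ?_
  obtain ⟨a, rfl⟩ := h.exists_sum_eq x
  rw [Finset.smul_sum]
  refine Finset.sum_eq_zero fun i _ => ?_
  rw [← smul_comm, show t • c i = 0 from congrFun ht i, smul_zero]

/-- This is `Hom_S(-, C)` applied to `S^p → S^q → C → 0`: a tuple satisfying the relations of `C` is
an endomorphism of `C`, hence a homothety by an element of `T`. -/
theorem HomothetyBijective.exact (hT : HomothetyBijective S T C) (h : IsPresentation c s) :
    Function.Exact (LinearMap.toSpanSingleton T (Fin q → C) c) (rowMap T C s) := by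
  intro x
  constructor
  · intro hx
    obtain ⟨φ, hφ⟩ := h.exists_lift x (fun j => congrFun hx j)
    obtain ⟨t, ht⟩ := hT.exists_eq φ
    exact ⟨t, funext fun i => by simp [← hφ, ht]⟩
  · rintro ⟨t, rfl⟩
    funext j
    simp only [rowMap_apply, LinearMap.toSpanSingleton_apply, Pi.smul_apply, smul_comm _ t]
    rw [← Finset.smul_sum, h.relation, smul_zero, Pi.zero_apply]

theorem HomothetyBijective.exists_injective (hT : HomothetyBijective S T C)
    (h : IsPresentation c s) :
    ∃ k : ((Fin q → C) ⧸ LinearMap.range (LinearMap.toSpanSingleton T (Fin q → C) c)) →ₗ[T]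
      (Fin p → C), Function.Injective k ∧ ∀ x, k (Submodule.Quotient.mk x) = rowMap T C s x := by
  have hex := LinearMap.exact_iff.1 (hT.exact h)
  refine ⟨Submodule.liftQ _ (rowMap T C s) hex.ge, ?_, fun x => rfl⟩
  rw [← LinearMap.ker_eq_bot]
  exact Submodule.ker_liftQ_eq_bot _ _ _ hex.le

end Rows

/-! ### The functors `C ⊗_R -` and `Hom_S(C, -)`, with unit and counit. -/

section Bimodule

variable {R S : Type u} [Ring R] [Ring S]
variable {C : Type u} [AddCommGroup C] [Module S C] [Module Rᵐᵒᵖ C] [SMulCommClass S Rᵐᵒᵖ C]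
variable {M M' M'' : Type u} [AddCommGroup M] [Module R M] [AddCommGroup M'] [Module R M']
  [AddCommGroup M''] [Module R M'']
variable {X X' X'' : Type u} [AddCommGroup X] [Module S X] [AddCommGroup X'] [Module S X']
  [AddCommGroup X''] [Module S X'']

namespace BimoduleHom

theorem ext {f g : BimoduleHom S C X} (h : ∀ c, f c = g c) : f = g := LinearMap.ext h

/-- Regard a linear map as an element of `Hom_S(C, X)`. -/
def of (f : C →ₗ[S] X) : BimoduleHom S C X := f

/-- The linear map underlying an element of `Hom_S(C, X)`. -/
def toLinearMap (f : BimoduleHom S C X) : C →ₗ[S] X := f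

@[simp] theorem of_apply (f : C →ₗ[S] X) (c : C) : of f c = f c := rfl

@[simp] theorem toLinearMap_apply (f : BimoduleHom S C X) (c : C) : toLinearMap f c = f c := rfl

/-- Evaluation as a biadditive map. -/
def eval : C →+ BimoduleHom S C X →+ X :=
  AddMonoidHom.mk' (fun c => AddMonoidHom.mk' (fun f => f c) (fun _ _ => rfl))
    (fun a b => AddMonoidHom.ext fun f => map_add (toLinearMap f) a b)

theorem add_apply (f g : BimoduleHom S C X) (c : C) : (f + g) c = f c + g c := rfl

theorem sub_apply (f g : BimoduleHom S C X) (c : C) : (f - g) c = f c - g c := rfl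

theorem zero_apply (c : C) : (0 : BimoduleHom S C X) c = 0 := rfl

theorem sum_apply {ι : Type*} (s : Finset ι) (f : ι → BimoduleHom S C X) (c : C) :
    (∑ i ∈ s, f i) c = ∑ i ∈ s, f i c := map_sum (eval c) f s

/-- Functoriality of `Hom_S(C, -)`. -/
def map (f : X →ₗ[S] X') : BimoduleHom S C X →ₗ[R] BimoduleHom S C X' where
  toFun g := of (f.comp (toLinearMap g))
  map_add' _ _ := ext fun _ => map_add f _ _
  map_smul' _ _ := rfl

theorem map_apply (f : X →ₗ[S] X') (g : BimoduleHom S C X) (c : C) :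
    map (R := R) f g c = f (g c) := rfl

end BimoduleHom

variable (S C) in
/-- Functoriality of `C ⊗_R -`, with its `S`-linearity. -/
def Tensor.mapRight (f : M →ₗ[R] M') : Tensor R C M →ₗ[S] Tensor R C M' :=
  { Tensor.map R (LinearMap.id : C →ₗ[Rᵐᵒᵖ] C) f with
    map_smul' := fun s t => Tensor.map_comm (Module.toModuleEnd Rᵐᵒᵖ (S := S) C s) f t }

theorem Tensor.mapRight_apply (f : M →ₗ[R] M') (t : Tensor R C M) :
    Tensor.mapRight S C f t = Tensor.map R LinearMap.id f t := rfl

theorem Tensor.mapRight_bijective {f : M →ₗ[R] M'} (hf : Function.Bijective f) :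
    Function.Bijective (Tensor.mapRight S C f) := by
  let e := LinearEquiv.ofBijective f hf
  refine Function.bijective_iff_has_inverse.2 ⟨Tensor.mapRight S C e.symm.toLinearMap, ?_, ?_⟩
  · intro t
    refine Tensor.addHom_ext (f := ((Tensor.mapRight S C e.symm.toLinearMap).comp
      (Tensor.mapRight S C f)).toAddMonoidHom) (g := AddMonoidHom.id _) (fun c m => ?_) t
    exact congrArg (Tensor.tmul R c) (e.symm_apply_apply m)
  · intro t
    refine Tensor.addHom_ext (f := ((Tensor.mapRight S C f).comp
      (Tensor.mapRight S C e.symm.toLinearMap)).toAddMonoidHom)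
      (g := AddMonoidHom.id _) (fun c m => ?_) t
    exact congrArg (Tensor.tmul R c) (e.apply_symm_apply m)

variable (R S C M) in
/-- The unit `M → Hom_S(C, C ⊗_R M)`. -/
def unit : M →ₗ[R] BimoduleHom S C (Tensor R C M) where
  toFun m := BimoduleHom.of
    { toFun := fun c => Tensor.tmul R c m
      map_add' := fun a b => Tensor.add_tmul a b m
      map_smul' := fun _ _ => rfl }
  map_add' m m' := BimoduleHom.ext fun c => Tensor.tmul_add c m m'
  map_smul' r m := BimoduleHom.ext fun c => (Tensor.op_smul_tmul r c m).symm

variable (R S C X) in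
/-- The counit `C ⊗_R Hom_S(C, X) → X`. -/
def counit : Tensor R C (BimoduleHom S C X) →ₗ[S] X :=
  { Tensor.lift (R := R) (BimoduleHom.eval (S := S) (C := C) (X := X)) (fun _ _ _ => rfl) with
    map_smul' := fun s t => Tensor.addHom_ext
      (f := (Tensor.lift (R := R) (BimoduleHom.eval (S := S) (C := C) (X := X))
        (fun _ _ _ => rfl)).comp (Tensor.leftAction R S C _ s))
      (g := (DistribSMul.toAddMonoidHom X s).comp
        (Tensor.lift (R := R) (BimoduleHom.eval (S := S) (C := C) (X := X)) (fun _ _ _ => rfl)))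
      (fun c f => map_smul (BimoduleHom.toLinearMap f) s c) t }

theorem counit_tmul (c : C) (f : BimoduleHom S C X) :
    counit R S C X (Tensor.tmul R c f) = f c := rfl

theorem counit_naturality (f : X →ₗ[S] X') (t : Tensor R C (BimoduleHom S C X)) :
    counit R S C X' (Tensor.mapRight S C (BimoduleHom.map f) t) = f (counit R S C X t) :=
  Tensor.addHom_ext
    (f := ((counit R S C X').comp (Tensor.mapRight S C (BimoduleHom.map f))).toAddMonoidHom)
    (g := (f.comp (counit R S C X)).toAddMonoidHom) (fun _ _ => rfl) t

theorem unit_naturality (f : M →ₗ[R] M') (m : M) :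
    unit R S C M' (f m) = BimoduleHom.map (R := R) (Tensor.mapRight S C f) (unit R S C M m) := rfl

theorem Tensor.coord_map_rowMap {p q : ℕ} (s : Fin p → Fin q → S) (t : Tensor R (Fin q → C) M)
    (j : Fin p) :
    Tensor.coord j (Tensor.map R (rowMap Rᵐᵒᵖ C s) LinearMap.id t)
      = ∑ i, s j i • Tensor.coord i t := by
  induction t using Tensor.induction_on with
  | zero => simp
  | tmul a m =>
    simp [Tensor.map_tmul, Tensor.coord_tmul, rowMap_apply, Tensor.smul_tmul', Tensor.sum_tmul]
  | add x y hx hy => simp [hx, hy, Finset.sum_add_distrib]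

/-! ### Purity of the functors -/

/-- A matrix over `S` acts on `C ⊗ -` through a map `E : C^q → C^p` of right `R`-modules. The
obstruction to solving a system with right-hand side `y` lies in `coker E ⊗ P`, which injects into
`coker E ⊗ M`, where it vanishes. -/
theorem isPureExact_tensor {P : Submodule R M} (hP : IsPureSubmodule P) :
    IsPureExact (Tensor.mapRight S C P.subtype) (Tensor.mapRight S C P.mkQ) := by
  obtain ⟨h1, h2, h3⟩ := hP C
  refine IsPureExact.of_systems h1 h2 h3 fun p q s x y hxy => ?_
  let E := rowMap Rᵐᵒᵖ C s
  let Q := LinearMap.range E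
  have hE : Function.Exact E Q.mkQ := LinearMap.exact_map_mkQ_range E
  have hy : Tensor.map R LinearMap.id P.subtype (Tensor.ofCoord y)
      = Tensor.map R E LinearMap.id (Tensor.ofCoord x) := by
    refine Tensor.eq_of_coord_eq fun j => ?_
    rw [Tensor.coord_map_rowMap, Tensor.coord_map_right]
    simp only [Tensor.coord_ofCoord, hxy, Tensor.mapRight_apply]
  have hy0 : Tensor.map R Q.mkQ LinearMap.id (Tensor.ofCoord y) = 0 := by
    refine (injective_iff_map_eq_zero _).1 (hP _).1 _ ?_
    rw [Tensor.map_comm, hy]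
    exact (Tensor.exact_map_left hE Q.mkQ_surjective _).2 ⟨_, rfl⟩
  obtain ⟨z, hz⟩ := (Tensor.exact_map_left hE Q.mkQ_surjective _).1 hy0
  refine ⟨fun i => Tensor.coord i z, fun j => ?_⟩
  rw [← Tensor.coord_map_rowMap, hz, Tensor.coord_ofCoord]

/-- The case `C = S = R` of `isPureExact_tensor`, transported along `R ⊗_R M ≅ M`. -/
theorem isPureExact_subtype_mkQ {P : Submodule R M} (hP : IsPureSubmodule P) :
    IsPureExact P.subtype P.mkQ := by
  refine ⟨P.injective_subtype, LinearMap.exact_subtype_mkQ P, P.mkQ_surjective,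
    fun K _ _ hK φ => ?_⟩
  let ι : (M ⧸ P) →ₗ[R] Tensor R R (M ⧸ P) :=
    { toFun := fun m => Tensor.tmul R 1 m
      map_add' := fun a b => Tensor.tmul_add 1 a b
      map_smul' := fun r m => by
        rw [RingHom.id_apply, Tensor.smul_tmul', ← Tensor.op_smul_tmul, smul_eq_mul, mul_one,
          op_smul_eq_mul, one_mul] }
  obtain ⟨ψ, hψ⟩ := (isPureExact_tensor (S := R) (C := R) hP).exists_lift K hK (ι.comp φ)
  refine ⟨Tensor.lid.comp ψ, LinearMap.ext fun x => ?_⟩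
  have hnat : ∀ t : Tensor R R M, P.mkQ (Tensor.lid t) = Tensor.lid (Tensor.mapRight R R P.mkQ t) :=
    Tensor.addHom_ext (f := (P.mkQ.comp Tensor.lid).toAddMonoidHom)
      (g := (Tensor.lid.comp (Tensor.mapRight R R P.mkQ)).toAddMonoidHom) (fun a m =>
        P.mkQ.map_smul a m)
  have h1 : Tensor.mapRight R R P.mkQ (ψ x) = Tensor.tmul R 1 (φ x) := LinearMap.congr_fun hψ x
  rw [LinearMap.comp_apply, LinearMap.comp_apply, hnat, h1, Tensor.lid_tmul, one_smul]

/-- By adjunction, lifting a map `K → Hom_S(C, X'')` means lifting a map `C ⊗_R K → X''`, and `C ⊗_R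
K` is finitely presented over `S` when `K` is over `R`. -/
theorem BimoduleHom.isPureExact {f : X' →ₗ[S] X} {g : X →ₗ[S] X''} (h : IsPureExact f g)
    [Module.FinitePresentation S C] :
    IsPureExact (BimoduleHom.map (R := R) (C := C) f) (BimoduleHom.map (R := R) (C := C) g) := by
  refine ⟨?_, ?_, ?_, ?_⟩
  · intro a b hab
    exact BimoduleHom.ext fun c => h.injective (DFunLike.congr_fun hab c)
  · intro a
    constructor
    · intro ha
      obtain ⟨b, hb⟩ := h.exists_factor (BimoduleHom.toLinearMap a) (DFunLike.congr_fun ha)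
      exact ⟨BimoduleHom.of b, BimoduleHom.ext hb⟩
    · rintro ⟨b, rfl⟩
      exact BimoduleHom.ext fun c => h.exact.apply_apply_eq_zero _
  · intro a
    obtain ⟨b, hb⟩ := h.exists_lift C inferInstance (BimoduleHom.toLinearMap a)
    exact ⟨BimoduleHom.of b, BimoduleHom.ext (LinearMap.congr_fun hb)⟩
  · intro K _ _ _ φ
    have : SMulCommClass Rᵐᵒᵖ S C := SMulCommClass.symm S Rᵐᵒᵖ C
    obtain ⟨q, p, e, r, her⟩ := exists_isPresentation (R := R) (M := K)
    -- The cokernel of `E : C^p → C^q`, the transposed relation matrix of `K` acting on `C` from the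
    -- right, stands in for `C ⊗_R K`.
    let E := rowMap S C (fun (i : Fin q) (j : Fin p) => MulOpposite.op (r j i))
    let Φ : (Fin q → C) →ₗ[S] X'' :=
      ∑ i, (BimoduleHom.toLinearMap (φ (e i))).comp (LinearMap.proj i)
    have hΦ : ∀ x, Φ x = ∑ i, φ (e i) (x i) := fun x => by simp [Φ]
    have hE : LinearMap.range E ≤ LinearMap.ker Φ := by
      rintro _ ⟨x, rfl⟩
      have h0 : ∀ j, ∑ i, φ (e i) (MulOpposite.op (r j i) • x j) = 0 := fun j => by
        have := DFunLike.congr_fun (congrArg φ (her.relation j)) (x j)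
        rw [map_sum, BimoduleHom.sum_apply, map_zero, BimoduleHom.zero_apply] at this
        simpa [BimoduleHom.smul_apply] using this
      rw [LinearMap.mem_ker, hΦ]
      have h2 : ∀ i, φ (e i) (E x i) = ∑ j, φ (e i) (MulOpposite.op (r j i) • x j) := fun i =>
        map_sum (BimoduleHom.toLinearMap (φ (e i))) (fun j => MulOpposite.op (r j i) • x j)
          Finset.univ
      simp only [h2]
      rw [Finset.sum_comm]
      exact Finset.sum_eq_zero fun j _ => h0 j
    obtain ⟨Ψ, hΨ⟩ := h.exists_lift _ (finitePresentation_quotient_range E)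
      ((LinearMap.range E).liftQ Φ hE)
    have hΨ' : ∀ x, g (Ψ (Submodule.Quotient.mk x)) = Φ x := fun x =>
      LinearMap.congr_fun hΨ (Submodule.Quotient.mk x)
    obtain ⟨ψ, hψ⟩ := her.exists_lift (N := BimoduleHom S C X)
      (fun i => BimoduleHom.of
        ((Ψ.comp (LinearMap.range E).mkQ).comp (LinearMap.single S (fun _ => C) i))) (fun j => by
        refine BimoduleHom.ext fun c => ?_
        rw [BimoduleHom.sum_apply]
        simp only [BimoduleHom.smul_apply, BimoduleHom.of_apply, LinearMap.comp_apply]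
        rw [← map_sum, ← map_sum]
        simp only [LinearMap.single_apply]
        rw [LinearMap.sum_single_apply (fun _ : Fin q => C)
          (fun i => MulOpposite.op (r j i) • c)]
        have : (fun i => MulOpposite.op (r j i) • c) ∈ LinearMap.range E := by
          refine ⟨Pi.single j c, funext fun i => ?_⟩
          simp [E, rowMap_apply, Pi.single_apply, smul_ite]
        rw [Submodule.mkQ_apply, (Submodule.Quotient.mk_eq_zero _).2 this, map_zero]
        rfl)
    refine ⟨ψ, her.hom_ext fun i => BimoduleHom.ext fun c => ?_⟩
    rw [LinearMap.comp_apply, hψ, BimoduleHom.map_apply, BimoduleHom.of_apply]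
    refine (hΨ' _).trans ?_
    rw [hΦ, Finset.sum_eq_single i]
    · simp
    · intro b _ hb
      simp only [LinearMap.single_apply, Pi.single_eq_of_ne hb]
      exact map_zero (BimoduleHom.toLinearMap _)
    · simp

end Bimodule

section Foxby

variable {R S : Type u} [Ring R] [Ring S]
variable {C : Type u} [AddCommGroup C] [Module S C] [Module Rᵐᵒᵖ C] [SMulCommClass S Rᵐᵒᵖ C]
variable {M M' M'' : Type u} [AddCommGroup M] [Module R M] [AddCommGroup M'] [Module R M']
  [AddCommGroup M''] [Module R M'']
variable {X X' X'' : Type u} [AddCommGroup X] [Module S X] [AddCommGroup X'] [Module S X']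
  [AddCommGroup X''] [Module S X'']
variable {p q : ℕ}

/-! ### Bijectivity of the unit, on `fp_n`-flat modules and on pure submodules. -/

section Unit

variable {c : Fin q → C} {s : Fin p → Fin q → S}

variable (R M) in
theorem Tensor.coord_map_toSpanSingleton (c : Fin q → C) (m : M) (i : Fin q) :
    Tensor.coord i (Tensor.map R (LinearMap.toSpanSingleton Rᵐᵒᵖ (Fin q → C) c) LinearMap.id
      (Tensor.tmul R 1 m)) = Tensor.tmul R (c i) m := by
  rw [Tensor.map_tmul, Tensor.coord_tmul]
  simp

/-- Evaluating the unit at the `c i` gives the coordinates of `R ⊗ M → C^q ⊗ M`. -/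
theorem unit_injective
    (hu : Function.Injective (Tensor.map R (LinearMap.toSpanSingleton Rᵐᵒᵖ (Fin q → C) c)
      (LinearMap.id : M →ₗ[R] M))) : Function.Injective (unit R S C M) := by
  intro m m' h
  have : Tensor.tmul R (1 : Rᵐᵒᵖ) m = Tensor.tmul R 1 m' := hu <| Tensor.eq_of_coord_eq fun i => by
    rw [Tensor.coord_map_toSpanSingleton, Tensor.coord_map_toSpanSingleton]
    exact DFunLike.congr_fun h (c i)
  simpa [Tensor.opLid_tmul] using congrArg Tensor.opLid this

/-- `φ` is determined by the tuple of its values on the generators, an element of `C^q ⊗ M`. It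
comes from the unit once this tuple comes from `R ⊗ M`, and the obstruction is its class in `(C^q /
cR) ⊗ M`. -/
theorem exists_unit_eq (h : IsPresentation c s) (φ : BimoduleHom S C (Tensor R C M))
    (hφ : Tensor.map R (LinearMap.range (LinearMap.toSpanSingleton Rᵐᵒᵖ (Fin q → C) c)).mkQ
      (LinearMap.id : M →ₗ[R] M) (Tensor.ofCoord fun i => φ (c i)) = 0) :
    ∃ m, unit R S C M m = φ := by
  obtain ⟨t, ht⟩ := (Tensor.exact_map_left (LinearMap.exact_map_mkQ_range _)
    (Submodule.mkQ_surjective _) _).1 hφ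
  refine ⟨Tensor.opLid t, h.hom_ext (f := (unit R S C M (Tensor.opLid t)).toLinearMap)
    (g := φ.toLinearMap) fun i => ?_⟩
  have := congrArg (Tensor.coord i) ht
  rw [← Tensor.one_tmul_opLid t, Tensor.coord_map_toSpanSingleton, Tensor.coord_ofCoord] at this
  exact this

/-- An `fp_n`-flat module lies in the Auslander class. -/
theorem unit_bijective_of_isFpFlat (hT : HomothetyBijective S Rᵐᵒᵖ C) (h : IsPresentation c s)
    (hC : ∀ n, IsFP Rᵐᵒᵖ n C) {n : ℕ} (hn : 0 < n) (hM : IsFpFlat R n M) :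
    Function.Bijective (unit R S C M) := by
  obtain ⟨n, rfl⟩ := Nat.exists_eq_succ_of_ne_zero hn.ne'
  have hCq : ∀ q : ℕ, IsFP Rᵐᵒᵖ (n + 1) (Fin q → C) := fun q => (hC _).pi q
  refine ⟨unit_injective (hM _ _ _ (IsFP.self _).finitelyNPresented (hCq q).finitelyNPresented
    (hT.injective h)), fun φ => exists_unit_eq h φ ?_⟩
  -- Flatness makes `(C^q / cR) ⊗ M → C^p ⊗ M` injective, and the obstruction maps to zero there
  -- because `φ` respects the relations among the generators.
  obtain ⟨k, hk, hks⟩ := hT.exists_injective h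
  refine (injective_iff_map_eq_zero _).1 (hM _ _ k
    ((hCq q).quotient_range _ (hT.injective h)).finitelyNPresented
    (hCq p).finitelyNPresented hk) _ ?_
  rw [Tensor.map_map]
  have : k.comp (LinearMap.range (LinearMap.toSpanSingleton Rᵐᵒᵖ (Fin q → C) c)).mkQ
      = rowMap Rᵐᵒᵖ C s := LinearMap.ext hks
  rw [this]
  refine Tensor.eq_of_coord_eq fun j => ?_
  rw [map_zero, LinearMap.comp_id, Tensor.coord_map_rowMap]
  simp only [Tensor.coord_ofCoord]
  have h0 := congrArg φ.toLinearMap (h.relation j)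
  rw [map_sum, map_zero] at h0
  simpa using h0

/-- The obstruction of `exists_unit_eq` lies in `(C^q / cR) ⊗ P`; by purity it may be tested in
`(C^q / cR) ⊗ M`, where surjectivity of the unit of `M` kills it. -/
theorem unit_bijective_of_isPureSubmodule (h : IsPresentation c s) {P : Submodule R M}
    (hP : IsPureSubmodule P) (hM : Function.Bijective (unit R S C M)) :
    Function.Bijective (unit R S C P) := by
  constructor
  · intro a b hab
    refine P.injective_subtype (hM.1 ?_)
    rw [unit_naturality, unit_naturality, hab]
  · intro φ
    obtain ⟨m, hm⟩ := hM.2 (BimoduleHom.map (R := R) (Tensor.mapRight S C P.subtype) φ)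
    refine exists_unit_eq h φ ((injective_iff_map_eq_zero _).1 (hP _).1 _ ?_)
    rw [Tensor.map_comm]
    refine (Tensor.exact_map_left (LinearMap.exact_map_mkQ_range _)
      (Submodule.mkQ_surjective _) _).2 ⟨Tensor.tmul R 1 m, Tensor.eq_of_coord_eq fun i => ?_⟩
    rw [Tensor.coord_map_toSpanSingleton, Tensor.coord_map_right, Tensor.coord_ofCoord]
    exact DFunLike.congr_fun hm (c i)

end Unit

/-! ### Bijectivity of the counit, on `fp_n`-injective modules and on pure submodules. -/

section Counit

variable {c : Fin q → C} {r : Fin p → Fin q → Rᵐᵒᵖ}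

/-- If `ψ` has components `ψ_i : C → X`, then `ψ c` is the image of `∑ c_i ⊗ ψ_i`. -/
theorem counit_surjective
    (hX : ∀ x : X, ∃ ψ : (Fin q → C) →ₗ[S] X, ψ c = x) : Function.Surjective (counit R S C X) := by
  intro x
  obtain ⟨ψ, rfl⟩ := hX x
  refine ⟨∑ i, Tensor.tmul R (c i)
    (BimoduleHom.of (ψ.comp (LinearMap.single S (fun _ => C) i))), ?_⟩
  rw [map_sum]
  simp only [counit_tmul, BimoduleHom.of_apply, LinearMap.comp_apply]
  rw [← map_sum]
  congr 1
  exact LinearMap.sum_single_apply (fun _ : Fin q => C) c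

theorem IsPresentation.exists_sum_tmul_eq (h : IsPresentation c r) (t : Tensor R C M) :
    ∃ m : Fin q → M, ∑ i, Tensor.tmul R (c i) (m i) = t := by
  induction t using Tensor.induction_on with
  | zero => exact ⟨0, by simp [Tensor.tmul_zero]⟩
  | tmul a m =>
    obtain ⟨a, rfl⟩ := h.exists_sum_eq a
    exact ⟨fun i => (a i).unop • m, by simp [Tensor.sum_tmul, Tensor.smul_tmul]⟩
  | add x y hx hy =>
    obtain ⟨m, rfl⟩ := hx
    obtain ⟨m', rfl⟩ := hy
    exact ⟨m + m', by simp [Tensor.tmul_add, Finset.sum_add_distrib]⟩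

/-- An `fp_n`-injective module lies in the Bass class. -/
theorem counit_bijective_of_isFpInjective [SMulCommClass Rᵐᵒᵖ S C]
    (hT : HomothetyBijective Rᵐᵒᵖ S C) (h : IsPresentation c r)
    (hC : ∀ n, IsFP S n C) {n : ℕ} (hn : 0 < n) (hX : IsFpInjective S n X) :
    Function.Bijective (counit R S C X) := by
  obtain ⟨n, rfl⟩ := Nat.exists_eq_succ_of_ne_zero hn.ne'
  have hCq : ∀ q : ℕ, IsFP S (n + 1) (Fin q → C) := fun q => (hC _).pi q
  constructor
  · rw [injective_iff_map_eq_zero]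
    intro t ht
    obtain ⟨g, rfl⟩ := h.exists_sum_tmul_eq t
    obtain ⟨k, hk, hkr⟩ := hT.exists_injective h
    -- That `∑ c_i ⊗ g_i` is in the kernel says that `G` kills `c`. So `G` factors through `C^q /
    -- Sc`, which embeds in `C^p`, and injectivity of `X` extends it to `H` on `C^p`.
    let G : (Fin q → C) →ₗ[S] X := ∑ i, (g i).toLinearMap.comp (LinearMap.proj i)
    have hG : ∀ x, G x = ∑ i, g i (x i) := fun x => by simp [G]
    have hGc : LinearMap.range (LinearMap.toSpanSingleton S (Fin q → C) c) ≤ LinearMap.ker G := by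
      rintro _ ⟨s, rfl⟩
      rw [map_sum] at ht
      simp only [counit_tmul] at ht
      rw [LinearMap.mem_ker, LinearMap.toSpanSingleton_apply, map_smul, hG, ht, smul_zero]
    obtain ⟨H, hH⟩ := hX _ _ k
      ((hCq q).quotient_range _ (hT.injective h)).finitelyNPresented
      (hCq p).finitelyNPresented hk (Submodule.liftQ _ G hGc)
    have hH' : ∀ x, H (rowMap S C r x) = G x := fun x => by
      rw [← hkr]
      exact LinearMap.congr_fun hH (Submodule.Quotient.mk x)
    have hg : ∀ i, g i = ∑ j, (r j i).unop •
        BimoduleHom.of (H.comp (LinearMap.single S (fun _ => C) j)) := fun i => by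
      refine BimoduleHom.ext fun x => ?_
      have h1 : G (Pi.single i x) = g i x := by
        rw [hG, Finset.sum_eq_single i]
        · simp
        · intro b _ hb
          rw [Pi.single_eq_of_ne hb]
          exact map_zero (g b).toLinearMap
        · simp
      rw [BimoduleHom.sum_apply, ← h1, ← hH']
      simp only [BimoduleHom.smul_apply, BimoduleHom.of_apply, LinearMap.comp_apply,
        MulOpposite.op_unop]
      rw [← map_sum]
      congr 1
      have h2 : rowMap S C r (Pi.single i x) = fun j => r j i • x := funext fun j => by
        rw [rowMap_apply, Finset.sum_eq_single i]
        · simp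
        · intro b _ hb
          rw [Pi.single_eq_of_ne hb, smul_zero]
        · simp
      rw [h2]
      exact (LinearMap.sum_single_apply (fun _ : Fin p => C) _).symm
    -- Moving the matrix entries across the tensor sign turns the sum into `∑_j (∑_i r_ji c_i) ⊗
    -- H_j`, whose left factors are relations of `C`.
    simp only [hg, Tensor.tmul_sum, ← Tensor.smul_tmul]
    rw [Finset.sum_comm]
    refine Finset.sum_eq_zero fun j _ => ?_
    rw [← Tensor.sum_tmul, h.relation, Tensor.zero_tmul]
  · refine counit_surjective (c := c) fun x => ?_
    obtain ⟨ψ, hψ⟩ := hX _ _ _ (IsFP.self _).finitelyNPresented (hCq q).finitelyNPresented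
      (hT.injective h) (LinearMap.toSpanSingleton S X x)
    exact ⟨ψ, by simpa using LinearMap.congr_fun hψ 1⟩

/-- Injectivity descends because `C ⊗ Hom_S(C, X') → C ⊗ Hom_S(C, X)` is injective by purity. For
surjectivity, a preimage of `f x` gives a map `C^q → X` with `c ↦ f x`, and `exists_extend` along `S
→ C^q` replaces it by a map to `X'` with `c ↦ x`. -/
theorem counit_bijective_of_isPureExact [Module.FinitePresentation Rᵐᵒᵖ C]
    (h : IsPresentation c r) (hC : IsFP S 1 C)
    {f : X' →ₗ[S] X} {g : X →ₗ[S] X''} (hfg : IsPureExact f g)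
    (hX : Function.Bijective (counit R S C X)) : Function.Bijective (counit R S C X') := by
  have := hC.finitelyNPresented.finitePresentation one_pos
  constructor
  · intro s t hst
    refine (BimoduleHom.isPureExact (R := R) (C := C) hfg).tensor_injective (A := C) (hX.1 ?_)
    refine (counit_naturality f s).trans (Eq.trans ?_ (counit_naturality f t).symm)
    rw [hst]
  · refine counit_surjective (c := c) fun x => ?_
    obtain ⟨t, ht⟩ := hX.2 (f x)
    obtain ⟨g, rfl⟩ := h.exists_sum_tmul_eq t
    rw [map_sum] at ht
    simp only [counit_tmul] at ht
    have := (hC.pi q).finitelyNPresented.finitePresentation one_pos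
    obtain ⟨χ, hχ⟩ := hfg.exists_extend (LinearMap.toSpanSingleton S (Fin q → C) c)
      (finitePresentation_quotient_range _) (LinearMap.toSpanSingleton S X' x)
      (∑ i, (g i).toLinearMap.comp (LinearMap.proj i)) (fun s => by
        simp only [LinearMap.toSpanSingleton_apply, map_smul]
        rw [← ht]
        simp)
    exact ⟨χ, by simpa using hχ 1⟩

end Counit

/-! ### Diagram chases for the unit and counit along pure exact sequences. -/

theorem unit_bijective_middle {f : M' →ₗ[R] M} {g : M →ₗ[R] M''} (h : IsPureExact f g)
    (hC : IsPureExact (Tensor.mapRight S C f) (Tensor.mapRight S C g))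
    (h' : Function.Bijective (unit R S C M')) (h'' : Function.Bijective (unit R S C M'')) :
    Function.Bijective (unit R S C M) := by
  constructor
  · rw [injective_iff_map_eq_zero]
    intro m hm
    have hgm : g m = 0 := by
      refine (injective_iff_map_eq_zero _).1 h''.1 _ ?_
      rw [unit_naturality, hm, map_zero]
    obtain ⟨m, rfl⟩ := (h.exact m).1 hgm
    suffices m = 0 by rw [this, map_zero]
    refine (injective_iff_map_eq_zero _).1 h'.1 _ (BimoduleHom.ext fun c => hC.injective ?_)
    have := DFunLike.congr_fun hm c
    rw [unit_naturality] at this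
    exact this.trans (map_zero (Tensor.mapRight S C f)).symm
  · intro φ
    obtain ⟨m, hm⟩ := h''.2 (BimoduleHom.map (R := R) (Tensor.mapRight S C g) φ)
    obtain ⟨m, rfl⟩ := h.surjective m
    obtain ⟨χ, hχ⟩ := hC.exists_factor (φ - unit R S C M m).toLinearMap (fun c => by
      have := DFunLike.congr_fun hm c
      rw [unit_naturality, BimoduleHom.map_apply, BimoduleHom.map_apply] at this
      rw [BimoduleHom.toLinearMap_apply, BimoduleHom.sub_apply, map_sub, this, sub_self])
    obtain ⟨m', hm'⟩ := h'.2 (BimoduleHom.of χ)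
    refine ⟨m + f m', BimoduleHom.ext fun c => ?_⟩
    rw [map_add, BimoduleHom.add_apply, unit_naturality, hm', BimoduleHom.map_apply,
      BimoduleHom.of_apply, hχ, BimoduleHom.toLinearMap_apply, BimoduleHom.sub_apply,
      add_sub_cancel]

/-- Unlike for the middle term, the row `Hom_S(C, C ⊗ -)` must be exact on the right; purity of the
tensored sequence and finite presentation of `C` provide this. -/
theorem unit_bijective_right {f : M' →ₗ[R] M} {g : M →ₗ[R] M''} (h : IsPureExact f g)
    (hC : IsPureExact (Tensor.mapRight S C f) (Tensor.mapRight S C g))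
    [Module.FinitePresentation S C]
    (h' : Function.Bijective (unit R S C M')) (hM : Function.Bijective (unit R S C M)) :
    Function.Bijective (unit R S C M'') := by
  have hH := BimoduleHom.isPureExact (R := R) (C := C) hC
  constructor
  · rw [injective_iff_map_eq_zero]
    intro m hm
    obtain ⟨m, rfl⟩ := h.surjective m
    rw [unit_naturality] at hm
    obtain ⟨φ, hφ⟩ := (hH.exact _).1 hm
    obtain ⟨m', rfl⟩ := h'.2 φ
    rw [← unit_naturality] at hφ
    rw [← hM.1 hφ, h.exact.apply_apply_eq_zero]
  · intro φ
    obtain ⟨φ, rfl⟩ := hH.surjective φ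
    obtain ⟨m, rfl⟩ := hM.2 φ
    exact ⟨g m, unit_naturality g m⟩

theorem counit_bijective_middle {f : X' →ₗ[S] X} {g : X →ₗ[S] X''} (h : IsPureExact f g)
    [Module.FinitePresentation S C]
    (h' : Function.Bijective (counit R S C X')) (h'' : Function.Bijective (counit R S C X'')) :
    Function.Bijective (counit R S C X) := by
  have hH := BimoduleHom.isPureExact (R := R) (C := C) h
  constructor
  · rw [injective_iff_map_eq_zero]
    intro t ht
    have hgt : Tensor.mapRight S C (BimoduleHom.map (R := R) g) t = 0 := by
      refine (injective_iff_map_eq_zero _).1 h''.1 _ ?_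
      rw [counit_naturality, ht, map_zero]
    obtain ⟨t, rfl⟩ := (Tensor.exact_map_right hH.exact hH.surjective _).1 hgt
    have h0 : f (counit R S C X' t) = 0 := (counit_naturality f t).symm.trans ht
    rw [(injective_iff_map_eq_zero _).1 h'.1 _ ((injective_iff_map_eq_zero f).1 h.injective _ h0),
      map_zero]
  · intro x
    obtain ⟨t, ht⟩ := h''.2 (g x)
    obtain ⟨t, rfl⟩ := Tensor.map_surjective (R := R) (f := (LinearMap.id : C →ₗ[Rᵐᵒᵖ] C))
      Function.surjective_id hH.surjective t
    have h1 : g (x - counit R S C X t) = 0 := by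
      rw [map_sub, ← counit_naturality, ← ht]
      exact sub_self _
    obtain ⟨x', hx'⟩ := (h.exact _).1 h1
    obtain ⟨t', rfl⟩ := h'.2 x'
    refine ⟨t + Tensor.mapRight S C (BimoduleHom.map f) t', ?_⟩
    rw [map_add, counit_naturality, hx', add_sub_cancel]

theorem counit_bijective_right {f : X' →ₗ[S] X} {g : X →ₗ[S] X''} (h : IsPureExact f g)
    [Module.FinitePresentation S C]
    (h' : Function.Bijective (counit R S C X')) (hX : Function.Bijective (counit R S C X)) :
    Function.Bijective (counit R S C X'') := by
  have hH := BimoduleHom.isPureExact (R := R) (C := C) h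
  constructor
  · rw [injective_iff_map_eq_zero]
    intro t ht
    obtain ⟨t, rfl⟩ := Tensor.map_surjective (R := R) (f := (LinearMap.id : C →ₗ[Rᵐᵒᵖ] C))
      Function.surjective_id hH.surjective t
    have h1 : g (counit R S C X t) = 0 := (counit_naturality g t).symm.trans ht
    obtain ⟨x', hx'⟩ := (h.exact _).1 h1
    obtain ⟨t', rfl⟩ := h'.2 x'
    rw [← counit_naturality] at hx'
    rw [← hX.1 hx']
    exact (Tensor.exact_map_right hH.exact hH.surjective _).2 ⟨t', rfl⟩
  · intro x
    obtain ⟨x, rfl⟩ := h.surjective x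
    obtain ⟨t, rfl⟩ := hX.2 x
    exact ⟨_, counit_naturality g t⟩

/-! ### Intrinsic descriptions of the two classes -/

/-- If `M ≅ Hom_S(C, X)`, the counit gives `Θ : C ⊗ M ≅ X`, so `X` is recovered from `M`. The
triangle identity writes the given isomorphism as `Hom_S(C, Θ)` after the unit, so the unit is
bijective too. -/
theorem isCFpInjective_iff {n : ℕ}
    (hX : ∀ (X : Type u) [AddCommGroup X] [Module S X], IsFpInjective S n X →
      Function.Bijective (counit R S C X)) :
    IsCFpInjective S R C n M ↔
      IsFpInjective S n (Tensor R C M) ∧ Function.Bijective (unit R S C M) := by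
  constructor
  · rintro ⟨X, _, _, hXn, ⟨e⟩⟩
    let Θ : Tensor R C M →ₗ[S] X := (counit R S C X).comp (Tensor.mapRight S C e.toLinearMap)
    have hΘ : Function.Bijective Θ := (hX X hXn).comp (Tensor.mapRight_bijective e.bijective)
    have hΘe : ∀ m c, Θ (unit R S C M m c) = e m c := fun m c => rfl
    refine ⟨hXn.of_equiv (LinearEquiv.ofBijective Θ hΘ).symm, fun m m' h => e.injective ?_,
      fun φ => ?_⟩
    · exact BimoduleHom.ext fun c => by rw [← hΘe, h, hΘe]
    · obtain ⟨m, hm⟩ := e.surjective (BimoduleHom.map (R := R) Θ φ)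
      refine ⟨m, BimoduleHom.ext fun c => hΘ.1 ?_⟩
      rw [hΘe, hm, BimoduleHom.map_apply]
  · rintro ⟨h, hb⟩
    exact ⟨_, _, _, h, ⟨LinearEquiv.ofBijective _ hb⟩⟩

/-- Dually, the unit identifies `Y` with `Hom_S(C, X)` by `Θ`, and the counit composed with `C ⊗ Θ`
is the inverse of the given isomorphism `X ≅ C ⊗ Y`. -/
theorem isCFpFlat_iff {n : ℕ}
    (hY : ∀ (Y : Type u) [AddCommGroup Y] [Module R Y], IsFpFlat R n Y →
      Function.Bijective (unit R S C Y)) :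
    IsCFpFlat S R C n X ↔
      IsFpFlat R n (BimoduleHom S C X) ∧ Function.Bijective (counit R S C X) := by
  constructor
  · rintro ⟨Y, _, _, hYn, ⟨e⟩⟩
    let Θ : Y →ₗ[R] BimoduleHom S C X :=
      (BimoduleHom.map e.symm.toLinearMap).comp (unit R S C Y)
    have he : Function.Bijective
        (BimoduleHom.map (R := R) (C := C) e.symm.toLinearMap) := by
      refine ⟨fun a b hab => BimoduleHom.ext fun c => ?_, fun a => ?_⟩
      · exact e.symm.injective (DFunLike.congr_fun hab c)
      · exact ⟨BimoduleHom.map (R := R) e.toLinearMap a,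
          BimoduleHom.ext fun c => e.symm_apply_apply _⟩
    have hΘ : Function.Bijective Θ := he.comp (hY Y hYn)
    refine ⟨hYn.of_equiv (LinearEquiv.ofBijective Θ hΘ), ?_⟩
    have hc : ∀ t, counit R S C X (Tensor.mapRight S C Θ t) = e.symm t :=
      Tensor.addHom_ext (f := ((counit R S C X).comp (Tensor.mapRight S C Θ)).toAddMonoidHom)
        (g := e.symm.toLinearMap.toAddMonoidHom) (fun c y => rfl)
    refine (Function.Bijective.of_comp_iff _ (Tensor.mapRight_bijective (S := S) (C := C) hΘ)).1 ?_
    rw [show counit R S C X ∘ Tensor.mapRight S C Θ = e.symm from funext hc]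
    exact e.symm.bijective
  · rintro ⟨h, hb⟩
    exact ⟨_, _, _, h, ⟨(LinearEquiv.ofBijective _ hb).symm⟩⟩

end Foxby

end CFp

/-! ### The theorem, assembled from the intrinsic descriptions. -/

theorem corollary3p12 {S R : Type u} [Ring S] [Ring R] {C : Type u} [AddCommGroup C]
    [Module S C] [Module Rᵐᵒᵖ C] [SMulCommClass S Rᵐᵒᵖ C]
    (hC : CFp.IsSemidualizing S R C) (n : ℕ) (hn : 0 < n) :
    (∀ (M : Type u) [AddCommGroup M] [Module R M] (M' : Submodule R M), CFp.IsPureSubmodule M' →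
      (CFp.IsCFpInjective S R C n M ↔
        CFp.IsCFpInjective S R C n M' ∧ CFp.IsCFpInjective S R C n (M ⧸ M'))) ∧
    (∀ (N : Type u) [AddCommGroup N] [Module S N] (N' : Submodule S N), CFp.IsPureSubmodule N' →
      (CFp.IsCFpFlat S R C n N ↔
        CFp.IsCFpFlat S R C n N' ∧ CFp.IsCFpFlat S R C n (N ⧸ N'))) := by
  have := SMulCommClass.symm S Rᵐᵒᵖ C
  have hl := hC.left_resolution.isFP
  have hr := hC.right_resolution.isFP
  have := (hl 1).finitelyNPresented.finitePresentation one_pos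
  have := (hr 1).finitelyNPresented.finitePresentation one_pos
  obtain ⟨q, p, c, s, hcs⟩ := CFp.exists_isPresentation (R := S) (M := C)
  obtain ⟨q', p', d, r, hdr⟩ := CFp.exists_isPresentation (R := Rᵐᵒᵖ) (M := C)
  have hT : CFp.HomothetyBijective S Rᵐᵒᵖ C := by
    refine ⟨fun t ht => ?_, fun φ => ?_⟩
    · have h0 : t.unop = 0 := hC.right_homothety.1 (LinearMap.ext fun c => by
        simpa using ht c)
      exact MulOpposite.unop_injective h0
    · obtain ⟨t, ht⟩ := hC.right_homothety.2 φ
      exact ⟨MulOpposite.op t, fun c => (LinearMap.congr_fun ht c).symm⟩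
  have hS : CFp.HomothetyBijective Rᵐᵒᵖ S C := by
    refine ⟨fun t ht => hC.left_homothety.1 (LinearMap.ext fun c => by simpa using ht c),
      fun φ => ?_⟩
    obtain ⟨t, ht⟩ := hC.left_homothety.2 φ
    exact ⟨t, fun c => (LinearMap.congr_fun ht c).symm⟩
  have hinj : ∀ (M : Type u) [AddCommGroup M] [Module R M], _ := fun M _ _ =>
    CFp.isCFpInjective_iff (M := M) (fun X _ _ hX =>
      CFp.counit_bijective_of_isFpInjective hS hdr hl hn hX)
  have hflat : ∀ (N : Type u) [AddCommGroup N] [Module S N], _ := fun N _ _ =>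
    CFp.isCFpFlat_iff (X := N) (fun Y _ _ hY =>
      CFp.unit_bijective_of_isFpFlat hT hcs hr hn hY)
  refine ⟨fun M _ _ M' hM' => ?_, fun N _ _ N' hN' => ?_⟩
  · have h1 := CFp.isPureExact_subtype_mkQ hM'
    have h2 := CFp.isPureExact_tensor (S := S) (C := C) hM'
    rw [hinj, hinj, hinj, h2.isFpInjective_iff hn]
    constructor
    · rintro ⟨⟨h', h''⟩, hb⟩
      have hb' := CFp.unit_bijective_of_isPureSubmodule hcs hM' hb
      exact ⟨⟨h', hb'⟩, h'', CFp.unit_bijective_right h1 h2 hb' hb⟩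
    · rintro ⟨⟨h', hb'⟩, h'', hb''⟩
      exact ⟨⟨h', h''⟩, CFp.unit_bijective_middle h1 h2 hb' hb''⟩
  · have h1 := CFp.isPureExact_subtype_mkQ hN'
    have h2 := CFp.BimoduleHom.isPureExact (R := R) (C := C) h1
    rw [hflat, hflat, hflat, h2.isFpFlat_iff hn]
    constructor
    · rintro ⟨⟨h', h''⟩, hb⟩
      have hb' := CFp.counit_bijective_of_isPureExact hdr (hl 1) h1 hb
      exact ⟨⟨h', hb'⟩, h'', CFp.counit_bijective_right h1 hb' hb⟩
    · rintro ⟨⟨h', hb'⟩, h'', hb''⟩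
      exact ⟨⟨h', h''⟩, CFp.counit_bijective_middle h1 hb' hb''⟩
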